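/- The Super Hierarchy (SH) algorithm runs in $O(n)$ time on planar graphs. Precisely: the input is a finite simple connected planar graph $G$ with vertices $0,\dots,n-1$ ($n\ge 1$), given by its numbers $n$ and $m$ of vertices and edges and an array that lists each edge $\{u_k,v_k\}$ exactly once, in any order, together with a real weight $w_k$. (Planar means: $G$ can be drawn in $\mathbb{R}^2$ with distinct points as vertices and with simple arcs joining their ends as edges, such that no arc passes through a vertex other than its ends and two different arcs meet at most in end points.) As long as the current graph has more than one vertex, the SH algorithm performs the following iteration (Borůvka's algorithm with edge contraction). 1. Nearest neighbour search: one pass over all edges finds for each vertex a lightest edge at it, ties being broken by the position in the edge list. The chosen edges are recorded, once each, as edges of the tree. 2. The auxiliary graph formed by the current vertices and the chosen edges is set up by histogram sorting the chosen edges by their ends, and its connected components are found by depth-first search. 3. Edge contraction and flattening: each connected component becomes a single vertex, the edges are histogram sorted lexicographically by their new ends, self-loops are removed, and parallel edges are replaced by the lightest one. The resulting simple weighted graph is the current graph of the next iteration. The algorithm is executed on a random access machine with integer registers, integer arrays and arrays of real weights, where every elementary operation (access to a constant, a register or an array entry, addition, subtraction, comparison, logical connective, assignment, branch) takes one step; weights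 may only be compared and copied. Theorem. There is an absolute constant $C$ such that for every $n$, every connected planar simple graph with $n$ vertices, every edge list of it, and all real edge weights, the SH algorithm halts after at most $C\,n$ steps. -/

import Mathlib

namespace SuperHierarchy

/-! ## Planar graphs -/

/-- A drawing of a simple graph in the plane without crossings: vertices are distinct points, every
edge is a simple arc joining its two ends, no arc passes through a vertex other than its ends, and
the arcs of two different edges meet at most in end points. (`curve e` is constrained only when `e`
is an edge.) -/
structure PlaneDrawing {V : Type*} (G : SimpleGraph V) where
  point : V → EuclideanSpace ℝ (Fin 2)
  point_injective : Function.Injective point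
  curve : Sym2 V → unitInterval → EuclideanSpace ℝ (Fin 2)
  curve_continuous : ∀ e ∈ G.edgeSet, Continuous (curve e)
  curve_injective : ∀ e ∈ G.edgeSet, Function.Injective (curve e)
  curve_ends : ∀ e ∈ G.edgeSet, s(curve e 0, curve e 1) = e.map point
  curve_avoids : ∀ e ∈ G.edgeSet, ∀ v t, curve e t = point v → t = 0 ∨ t = 1
  curve_disjoint : ∀ e ∈ G.edgeSet, ∀ f ∈ G.edgeSet, e ≠ f →
    ∀ s t, curve e s = curve f t → (s = 0 ∨ s = 1) ∧ (t = 0 ∨ t = 1)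

/-- A graph is planar if it can be drawn in the plane without crossings. -/
def IsPlanar {V : Type*} (G : SimpleGraph V) : Prop := Nonempty (PlaneDrawing G)

/-! ## The machine model

A random access machine with the uniform cost measure, programmed in a structured language. It has
finitely many integer registers, finitely many integer arrays, and finitely many arrays of real
weights. Weights can only be compared and copied. Every elementary operation (constant, register or
array access, addition, subtraction, comparison, connective, assignment, branch) costs one step. -/

/-- Integer registers. -/
inductive Reg
  /-- the numbers of vertices and of edges of the current graph (initially the input graph) -/
  | numV | numE
  /-- the number of tree edges recorded so far -/
  | numTree
  /-- the number of connected components of the auxiliary graph found so far -/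
  | numComp
  /-- the number of edges of the contracted graph written so far -/
  | numNew
  /-- loop counters -/
  | i | j
  /-- working registers -/
  | x | y | e | top | total
  deriving DecidableEq

/-- Integer arrays. -/
inductive Arr
  /-- the edge list of the current graph: end `src k` and end `dst k` of its `k`-th edge, and the
  number `name k` of the input edge that it stems from -/
  | src | dst | name
  /-- the edge list of the contracted graph while it is being built -/
  | newSrc | newDst | newName
  /-- the input edges added to the spanning tree, in the order in which they are added -/
  | tree
  /-- the lightest edge at each vertex -/
  | best
  /-- the arcs of the auxiliary graph; `arcs` sorted by their tail is `adj` -/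
  | tail | head | arcs | adj
  /-- the histogram used for sorting -/
  | bin
  /-- depth-first search: next arc to explore, component label, stack -/
  | next | label | stack
  /-- the smaller and the larger end of each edge after contraction -/
  | lo | hi
  /-- the edges before, in the middle of, and after lexicographic sorting -/
  | perm0 | perm1 | perm2
  deriving DecidableEq

/-- Arrays of real weights: those of the current graph, and those of the contracted graph while it
is being built. -/
inductive WArr
  | weight | newWeight
  deriving DecidableEq

/-- The memory of the machine. -/
structure Store where
  reg : Reg → ℕ
  arr : Arr → ℕ → ℕ
  wt : WArr → ℕ → ℝ

/-- Integer expressions; subtraction is truncated. -/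
inductive Exp
  | lit (k : ℕ)
  | reg (r : Reg)
  | get (a : Arr) (i : Exp)
  | plus (s t : Exp)
  | minus (s t : Exp)

instance (k : ℕ) : OfNat Exp k := ⟨Exp.lit k⟩
instance : Coe Reg Exp := ⟨Exp.reg⟩
instance : Add Exp := ⟨Exp.plus⟩
instance : Sub Exp := ⟨Exp.minus⟩

/-- Tests. `wlt a s b t` compares the `s`-th entry of the weight array `a` with the `t`-th entry of
the weight array `b`. -/
inductive Test
  | lt (s t : Exp)
  | eq (s t : Exp)
  | wlt (a : WArr) (s : Exp) (b : WArr) (t : Exp)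
  | and (p q : Test)
  | or (p q : Test)

/-- Programs. `set r s` is `r := s`, `put a s t` is `a[s] := t`, and `wput a s b t` is
`a[s] := b[t]` for weight arrays. -/
inductive Cmd
  | skip
  | set (r : Reg) (s : Exp)
  | put (a : Arr) (s t : Exp)
  | wput (a : WArr) (s : Exp) (b : WArr) (t : Exp)
  | seq (c d : Cmd)
  | ite (p : Test) (c d : Cmd)
  | loop (p : Test) (c : Cmd)

infixr:60 " ;; " => Cmd.seq

/-- The value of an expression. -/
def Exp.eval (σ : Store) : Exp → ℕ
  | .lit k => k
  | .reg r => σ.reg r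
  | .get a i => σ.arr a (i.eval σ)
  | .plus s t => s.eval σ + t.eval σ
  | .minus s t => s.eval σ - t.eval σ

/-- The number of steps for evaluating an expression. -/
def Exp.cost : Exp → ℕ
  | .lit _ => 1
  | .reg _ => 1
  | .get _ i => i.cost + 1
  | .plus s t => s.cost + t.cost + 1
  | .minus s t => s.cost + t.cost + 1

/-- The truth of a test. -/
def Test.Holds (σ : Store) : Test → Prop
  | .lt s t => s.eval σ < t.eval σ
  | .eq s t => s.eval σ = t.eval σ
  | .wlt a s b t => σ.wt a (s.eval σ) < σ.wt b (t.eval σ)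
  | .and p q => p.Holds σ ∧ q.Holds σ
  | .or p q => p.Holds σ ∨ q.Holds σ

/-- The number of steps for evaluating a test. -/
def Test.cost : Test → ℕ
  | .lt s t => s.cost + t.cost + 1
  | .eq s t => s.cost + t.cost + 1
  | .wlt _ s _ t => s.cost + t.cost + 3
  | .and p q => p.cost + q.cost + 1
  | .or p q => p.cost + q.cost + 1

def Store.setReg (σ : Store) (r : Reg) (v : ℕ) : Store :=
  { σ with reg := Function.update σ.reg r v }

def Store.setArr (σ : Store) (a : Arr) (i v : ℕ) : Store :=
  { σ with arr := Function.update σ.arr a (Function.update (σ.arr a) i v) }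

noncomputable def Store.setWt (σ : Store) (a : WArr) (i : ℕ) (v : ℝ) : Store :=
  { σ with wt := Function.update σ.wt a (Function.update (σ.wt a) i v) }

/-- `Exec c σ t τ`: the program `c`, started with memory `σ`, halts after exactly `t` steps with
memory `τ`. -/
inductive Exec : Cmd → Store → ℕ → Store → Prop
  | skip (σ : Store) : Exec .skip σ 1 σ
  | set (r : Reg) (s : Exp) (σ : Store) :
      Exec (.set r s) σ (s.cost + 1) (σ.setReg r (s.eval σ))
  | put (a : Arr) (s t : Exp) (σ : Store) :
      Exec (.put a s t) σ (s.cost + t.cost + 1) (σ.setArr a (s.eval σ) (t.eval σ))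
  | wput (a : WArr) (s : Exp) (b : WArr) (t : Exp) (σ : Store) :
      Exec (.wput a s b t) σ (s.cost + t.cost + 2) (σ.setWt a (s.eval σ) (σ.wt b (t.eval σ)))
  | seq {c d : Cmd} {σ τ υ : Store} {k l : ℕ} :
      Exec c σ k τ → Exec d τ l υ → Exec (.seq c d) σ (k + l) υ
  | ite_true {p : Test} {c d : Cmd} {σ τ : Store} {k : ℕ} :
      p.Holds σ → Exec c σ k τ → Exec (.ite p c d) σ (p.cost + 1 + k) τ
  | ite_false {p : Test} {c d : Cmd} {σ τ : Store} {k : ℕ} :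
      ¬ p.Holds σ → Exec d σ k τ → Exec (.ite p c d) σ (p.cost + 1 + k) τ
  | loop_false {p : Test} {c : Cmd} {σ : Store} :
      ¬ p.Holds σ → Exec (.loop p c) σ (p.cost + 1) σ
  | loop_true {p : Test} {c : Cmd} {σ τ υ : Store} {k l : ℕ} :
      p.Holds σ → Exec c σ k τ → Exec (.loop p c) τ l υ →
        Exec (.loop p c) σ (p.cost + 1 + k + l) υ

/-- The machine is deterministic: running time and result are determined by the program and the
initial memory. -/
theorem Exec.det {c : Cmd} {σ : Store} {k l : ℕ} {τ υ : Store} (h : Exec c σ k τ)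
    (h' : Exec c σ l υ) : k = l ∧ τ = υ := by
  induction h generalizing l υ with
  | skip | set | put | wput => cases h'; exact ⟨rfl, rfl⟩
  | seq _ _ ih₁ ih₂ =>
    cases h' with
    | seq a b =>
      obtain ⟨rfl, rfl⟩ := ih₁ a
      obtain ⟨rfl, rfl⟩ := ih₂ b
      exact ⟨rfl, rfl⟩
  | ite_true hp _ ih | ite_false hp _ ih =>
    cases h' with
    | ite_true hq a => first | exact absurd hq hp | (obtain ⟨rfl, rfl⟩ := ih a; exact ⟨rfl, rfl⟩)
    | ite_false hq a => first | exact absurd hp hq | (obtain ⟨rfl, rfl⟩ := ih a; exact ⟨rfl, rfl⟩)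
  | loop_false hp =>
    cases h' with
    | loop_false => exact ⟨rfl, rfl⟩
    | loop_true hq => exact absurd hq hp
  | loop_true hp _ _ ih₁ ih₂ =>
    cases h' with
    | loop_false hq => exact absurd hp hq
    | loop_true _ a b =>
      obtain ⟨rfl, rfl⟩ := ih₁ a
      obtain ⟨rfl, rfl⟩ := ih₂ b
      exact ⟨rfl, rfl⟩

/-! ## The algorithm -/

open Reg Arr WArr Exp Test Cmd

/-- `for r = 0, …, bound - 1 do c` (the body `c` changes neither `r` nor the bound). -/
def forLoop (r : Reg) (bound : Exp) (c : Cmd) : Cmd :=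
  set r 0 ;;
  loop (lt r bound) (c ;; set r (r + 1))

/-- Stable histogram sort: writes the first `len` entries `x` of the array `a`, ordered by their
keys `key[x] < range`, to the array `b`. At the end `bin[v]` is the position in `b` just behind
the last entry with key `v`. -/
def histogramSort (key : Arr) (range len : Exp) (a b : Arr) : Cmd :=
  forLoop j range (put bin j 0) ;;
  forLoop i len (
    set x (get key (get a i)) ;;
    put bin x (get bin x + 1)) ;;
  set total 0 ;;
  forLoop j range (
    set x (get bin j) ;;
    put bin j total ;;
    set total (total + x)) ;;
  forLoop i len (
    set x (get key (get a i)) ;;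
    put b (get bin x) (get a i) ;;
    put bin x (get bin x + 1))

/-- Nearest neighbour search: one pass over all edges finds for each vertex `v` the lightest edge
`best[v]` at `v`, the first one in the edge list among equally light ones. The value `numE` stands
for an edge not yet found. -/
def nearestNeighbours : Cmd :=
  forLoop i numV (put best i numE) ;;
  forLoop i numE (
    set x (get src i) ;;
    ite (or (eq (get best x) numE) (wlt weight i weight (get best x))) (put best x i) skip ;;
    set x (get dst i) ;;
    ite (or (eq (get best x) numE) (wlt weight i weight (get best x))) (put best x i) skip)

/-- The auxiliary graph: its vertices are the current vertices, its edges the chosen edges, entered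
as two opposite arcs for each vertex and histogram sorted by their tails. On the way, each chosen
edge is appended to the tree once, also when it was chosen from both of its ends. -/
def chooseEdges : Cmd :=
  forLoop i numV (
    set e (get best i) ;;
    set y (get src e + get dst e - i) ;;
    ite (and (eq (get best y) e) (lt y i)) skip (
      put tree numTree (get name e) ;;
      set numTree (numTree + 1)) ;;
    put tail i i ;;
    put head i y ;;
    put tail (numV + i) y ;;
    put head (numV + i) i ;;
    put arcs i i ;;
    put arcs (numV + i) (numV + i)) ;;
  histogramSort tail numV (numV + numV) arcs adj

/-- Tree growing: depth-first search in the auxiliary graph. Each vertex `v` receives the number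
`label[v]` of its connected component; `numV` stands for a vertex not yet visited. -/
def connectedComponents : Cmd :=
  set total 0 ;;
  forLoop i numV (
    put label i numV ;;
    put next i total ;;
    set total (get bin i)) ;;
  set numComp 0 ;;
  forLoop i numV (
    ite (eq (get label i) numV) (
      put label i numComp ;;
      put stack 0 i ;;
      set top 1 ;;
      loop (lt 0 top) (
        set x (get stack (top - 1)) ;;
        ite (lt (get next x) (get bin x)) (
          set y (get head (get adj (get next x))) ;;
          put next x (get next x + 1) ;;
          ite (eq (get label y) numV) (
            put label y numComp ;;
            put stack top y ;;
            set top (top + 1))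
            skip)
          (set top (top - 1))) ;;
      set numComp (numComp + 1))
      skip)

/-- Edge contraction and flattening: each component becomes one vertex, the edges are histogram
sorted lexicographically by their new ends, self-loops are removed, and parallel edges are replaced
by the lightest one. -/
def contract : Cmd :=
  forLoop i numE (
    set x (get label (get src i)) ;;
    set y (get label (get dst i)) ;;
    ite (lt x y) (put lo i x ;; put hi i y) (put lo i y ;; put hi i x) ;;
    put perm0 i i) ;;
  histogramSort hi numComp numE perm0 perm1 ;;
  histogramSort lo numComp numE perm1 perm2 ;;
  set numNew 0 ;;
  forLoop i numE (
    set e (get perm2 i) ;;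
    ite (eq (get lo e) (get hi e)) skip (
      ite (and (lt 0 numNew) (and (eq (get newSrc (numNew - 1)) (get lo e))
          (eq (get newDst (numNew - 1)) (get hi e))))
        (ite (wlt weight e newWeight (numNew - 1)) (
          wput newWeight (numNew - 1) weight e ;;
          put newName (numNew - 1) (get name e))
          skip) (
        put newSrc numNew (get lo e) ;;
        put newDst numNew (get hi e) ;;
        put newName numNew (get name e) ;;
        wput newWeight numNew weight e ;;
        set numNew (numNew + 1)))) ;;
  forLoop i numNew (
    put src i (get newSrc i) ;;
    put dst i (get newDst i) ;;
    put name i (get newName i) ;;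
    wput weight i newWeight i) ;;
  set numV numComp ;;
  set numE numNew

/-- The Super Hierarchy algorithm: as long as there is more than one vertex, join every vertex to
its nearest neighbour, contract, and flatten. -/
def superHierarchy : Cmd :=
  set numTree 0 ;;
  forLoop i numE (put name i i) ;;
  loop (lt 1 numV) (
    nearestNeighbours ;;
    chooseEdges ;;
    connectedComponents ;;
    contract)

/-! ## The input -/

/-- The pairs `{u k, v k}` list every edge of `G` exactly once. -/
def IsEdgeList {n m : ℕ} (G : SimpleGraph (Fin n)) (u v : Fin m → Fin n) : Prop :=
  Function.Injective (fun k => s(u k, v k)) ∧ Set.range (fun k => s(u k, v k)) = G.edgeSet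

/-- The memory `σ` holds the weighted graph with `n` vertices and with `m` edges `{u k, v k}` of
weight `w k`. Nothing is assumed about the rest of the memory. -/
def Store.Contains (σ : Store) {n m : ℕ} (u v : Fin m → Fin n) (w : Fin m → ℝ) : Prop :=
  σ.reg numV = n ∧ σ.reg numE = m ∧
    ∀ k : Fin m, σ.arr src k = u k ∧ σ.arr dst k = v k ∧ σ.wt weight k = w k

end SuperHierarchy

namespace SuperHierarchy

/-! ## Drawings in which only independent edges have to be disjoint -/

/-! One iteration costs O(n + m) steps on a current graph with n vertices and m edges. Every step is
a pass over vertices or edges, a histogram sort, or a depth-first search. Two facts turn this into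
O(n) in total. Every vertex chooses an edge, so every component of the auxiliary graph has at least
two vertices and n at least halves (`IsLabelling.two_mul_le`). And m ≤ 32 n holds for every current
graph, not only for the input (`IsGraph.card_edges_le`). The costs then form a geometric series
(`mainLoop_exec`).

The edge bound must survive contraction, so the loop invariant carries a property inherited by
minors. Planarity itself is awkward here, because contraction would require redrawing disjoint arcs.
It is replaced by `WeaklyDrawable`, where edges may be arbitrary connecting sets and only
independent edges must be disjoint. Then passing to a minor means merely taking unions
(`WeaklyDrawable.of_minor`).

Such a graph has no K₅ minor. For independent edges the difference of the two curves never vanishes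
on a square, so its logarithm has total increment zero around the boundary. The resulting integer
equations for the 15 independent pairs contradict each other modulo 2 (`not_weaklyDrawable_K5`). On
the other hand, by Mader's argument a graph with average degree at least 2^t has a complete minor on
t vertices (`exists_completeModel`). With t = 5 this gives the bound; its constant is far from
optimal, but any constant will do.

The rest is program verification. The steps spent by the depth-first search are paid by a potential
that counts unexplored arcs. Lightness of the chosen edges has no influence on the bound, so no
invariant mentions weights. -/

/-- A graph is weakly drawable if it can be drawn in the plane so that edges without a common end
are disjoint. This property is inherited by minors. -/
def WeaklyDrawable {V : Type*} (G : SimpleGraph V) : Prop :=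
  ∃ (p : V → ℂ) (S : Sym2 V → Set ℂ),
    (∀ a b, G.Adj a b → JoinedIn (S s(a, b)) (p a) (p b)) ∧
    ∀ a b c d, G.Adj a b → G.Adj c d → a ≠ c → a ≠ d → b ≠ c → b ≠ d →
      Disjoint (S s(a, b)) (S s(c, d))

/-- Arcs of different edges meet only in end points, which are images of vertices; four different
vertices have different images. The plane is identified with ℂ because logarithms are needed later.
-/
theorem IsPlanar.weaklyDrawable {V : Type*} {G : SimpleGraph V} (h : IsPlanar G) :
    WeaklyDrawable G := by
  obtain ⟨D⟩ := h
  let f : EuclideanSpace ℝ (Fin 2) → ℂ := fun x => ⟨x 0, x 1⟩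
  have hf : Continuous f := by
    have : f = fun x => ((x 0 : ℝ) : ℂ) + ((x 1 : ℝ) : ℂ) * Complex.I := by
      funext x; apply Complex.ext <;> simp [f]
    rw [this]; fun_prop
  have hinj : Function.Injective f := by
    intro x y hxy
    have h0 : x 0 = y 0 := congrArg Complex.re hxy
    have h1 : x 1 = y 1 := congrArg Complex.im hxy
    ext i; fin_cases i
    · exact h0
    · exact h1
  refine ⟨fun v => f (D.point v), fun e => f '' Set.range (D.curve e), ?_, ?_⟩
  · intro a b hab
    have he : s(a, b) ∈ G.edgeSet := hab
    have hj : JoinedIn (Set.range (D.curve s(a, b))) (D.curve s(a, b) 0) (D.curve s(a, b) 1) :=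
      ⟨⟨⟨D.curve s(a, b), D.curve_continuous _ he⟩, rfl, rfl⟩, fun t => ⟨t, rfl⟩⟩
    have hends := D.curve_ends _ he
    rw [Sym2.map_mk] at hends
    apply JoinedIn.map _ hf
    rcases Sym2.eq_iff.1 hends with ⟨h0, h1⟩ | ⟨h0, h1⟩
    · rw [h0, h1] at hj; exact hj
    · rw [h0, h1] at hj; exact hj.symm
  · intro a b c d hab hcd hac had hbc hbd
    have he : s(a, b) ∈ G.edgeSet := hab
    have he' : s(c, d) ∈ G.edgeSet := hcd
    rw [Set.disjoint_image_iff hinj, Set.disjoint_left]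
    rintro x ⟨s, rfl⟩ ⟨t, hst⟩
    have hne : s(a, b) ≠ s(c, d) := by
      intro h; rcases Sym2.eq_iff.1 h with ⟨h, -⟩ | ⟨h, -⟩ <;> contradiction
    obtain ⟨hs, ht⟩ := D.curve_disjoint _ he _ he' hne s t hst.symm
    have key : ∀ a b t, s(a, b) ∈ G.edgeSet → t = 0 ∨ t = 1 →
        D.curve s(a, b) t = D.point a ∨ D.curve s(a, b) t = D.point b := by
      intro a b t he ht
      have hends := D.curve_ends _ he
      rw [Sym2.map_mk] at hends
      rcases ht with rfl | rfl <;> rcases Sym2.eq_iff.1 hends with ⟨h0, h1⟩ | ⟨h0, h1⟩ <;>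
        simp [h0, h1]
    have := D.point_injective
    rcases key a b s he hs with h1 | h1 <;> rcases key c d t he' ht with h2 | h2 <;>
      rw [h1, h2] at hst <;> have := this hst <;> grind

/-- Vertices `x`, `y` joined by a walk of `G` inside `B`. -/
def ConnectedIn {V : Type*} (G : SimpleGraph V) (B : Set V) : Prop :=
  ∀ a ∈ B, ∀ b ∈ B, Relation.ReflTransGen (fun x y => G.Adj x y ∧ x ∈ B ∧ y ∈ B) a b

/-- A model of `H` as a minor of `G`. -/
structure IsMinorModel {V W : Type*} (H : SimpleGraph W) (G : SimpleGraph V) (B : W → Set V) :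
    Prop where
  disjoint : ∀ x y v, v ∈ B x → v ∈ B y → x = y
  connected : ∀ x, ConnectedIn G (B x)
  adj : ∀ x y, H.Adj x y → ∃ a ∈ B x, ∃ b ∈ B y, G.Adj a b

/-- An edge xy of the minor is drawn as the union of all edges of `G` with both ends in `B x ∪ B y`.
Independent edges of the minor involve disjoint branch sets, so only independent edges of `G` have
to be compared. Edges of the minor with a common end may overlap heavily, which the weak notion
permits. -/
theorem WeaklyDrawable.of_minor {V W : Type*} {H : SimpleGraph W} {G : SimpleGraph V}
    {B : W → Set V} (hB : IsMinorModel H G B) (hG : WeaklyDrawable G) : WeaklyDrawable H := by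
  classical
  obtain ⟨p, S, hj, hd⟩ := hG
  -- Branch sets may be empty. Such vertices are isolated in `H`, so the default value 0 is never
  -- constrained.
  let q : W → ℂ := fun x => if h : (B x).Nonempty then p h.choose else 0
  let T : Sym2 W → Set ℂ := fun e =>
    {z | ∃ a b, G.Adj a b ∧ (∃ x ∈ e, a ∈ B x) ∧ (∃ x ∈ e, b ∈ B x) ∧ z ∈ S s(a, b)}
  have hmono : ∀ e a b, G.Adj a b → (∃ x ∈ e, a ∈ B x) → (∃ x ∈ e, b ∈ B x) →
      JoinedIn (T e) (p a) (p b) := fun e a b hab ha hb =>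
    (hj a b hab).mono fun z hz => ⟨a, b, hab, ha, hb, hz⟩
  have hwalk : ∀ e, ∀ x ∈ e, ∀ a ∈ B x, p a ∈ T e → ∀ b ∈ B x, JoinedIn (T e) (p a) (p b) := by
    intro e x hx a ha hpa b hb
    have := hB.connected x a ha b hb
    induction this with
    | refl => exact JoinedIn.refl hpa
    | tail _ h ih => exact (ih h.2.1).trans (hmono e _ _ h.1 ⟨x, hx, h.2.1⟩ ⟨x, hx, h.2.2⟩)
  refine ⟨q, T, ?_, ?_⟩
  · intro x y hxy
    obtain ⟨a, ha, b, hb, hab⟩ := hB.adj x y hxy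
    have hx : x ∈ s(x, y) := Sym2.mem_mk_left x y
    have hy : y ∈ s(x, y) := Sym2.mem_mk_right x y
    have h1 := hmono s(x, y) a b hab ⟨x, hx, ha⟩ ⟨y, hy, hb⟩
    have hxn : (B x).Nonempty := ⟨a, ha⟩
    have hyn : (B y).Nonempty := ⟨b, hb⟩
    have hqx : q x = p hxn.choose := dif_pos hxn
    have hqy : q y = p hyn.choose := dif_pos hyn
    rw [hqx, hqy]
    exact ((hwalk _ x hx a ha h1.source_mem _ hxn.choose_spec).symm.trans h1).trans
      (hwalk _ y hy b hb h1.target_mem _ hyn.choose_spec)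
  · intro x y x' y' _ _ h1 h2 h3 h4
    rw [Set.disjoint_left]
    rintro z ⟨a, b, hab, ⟨u, hu, hau⟩, ⟨v, hv, hbv⟩, hz⟩
      ⟨a', b', hab', ⟨u', hu', hau'⟩, ⟨v', hv', hbv'⟩, hz'⟩
    have hne : ∀ u ∈ s(x, y), ∀ u' ∈ s(x', y'), ∀ a ∈ B u, ∀ a' ∈ B u', a ≠ a' := by
      intro u hu u' hu' a ha a' ha' h
      subst h
      have := hB.disjoint _ _ _ ha ha'
      subst this
      rw [Sym2.mem_iff] at hu hu'
      grind
    exact Set.disjoint_left.1 (hd a b a' b' hab hab' (hne _ hu _ hu' _ hau _ hau')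
      (hne _ hu _ hv' _ hau _ hbv') (hne _ hv _ hu' _ hbv _ hau')
      (hne _ hv _ hv' _ hbv _ hbv')) hz hz'

/-! ## The complete graph on five vertices is not weakly drawable -/

/-- The exponential is a covering of the punctured plane, and maps from a simply connected space
lift. -/
theorem exists_continuous_log {A : Type*} [TopologicalSpace A] [SimplyConnectedSpace A]
    [LocallyPathConnectedSpace A] [Nonempty A] {f : A → ℂ} (hf : Continuous f)
    (h0 : ∀ a, f a ≠ 0) : ∃ L : A → ℂ, Continuous L ∧ ∀ a, Complex.exp (L a) = f a := by
  obtain ⟨a₀⟩ := ‹Nonempty A›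
  obtain ⟨F, ⟨-, hF⟩, -⟩ := Complex.isCoveringMapOn_exp.existsUnique_continuousMap_lifts
    ⟨f, hf⟩ (a₀ := a₀) (e₀ := Complex.log (f a₀)) (Complex.exp_log (h0 a₀)) (fun a => h0 a)
  exact ⟨F, F.continuous, fun a => congrFun hF a⟩

/-- Both `f` and the constant `f s` lift the same map through the covering `exp`; lifts that agree
at one point of a connected space are equal. -/
theorem eq_of_exp_const {f : ℝ → ℂ} (hf : Continuous f)
    (h : ∀ s t, Complex.exp (f s) = Complex.exp (f t)) (s t : ℝ) : f s = f t := by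
  have hcov := Complex.isCoveringMap_exp
  have := hcov.eq_of_comp_eq (g₁ := f) (g₂ := fun _ => f s) hf continuous_const
    (by funext t; exact Subtype.ext (h t s)) s rfl
  exact (congrFun this t).symm

/-- Continuous logarithms of two proportional curves have the same increments. -/
theorem log_increment_eq {L L' : ℝ → ℂ} (hL : Continuous L) (hL' : Continuous L') (κ : ℂ)
    (h : ∀ s, Complex.exp (L s) = κ * Complex.exp (L' s)) :
    L 1 - L 0 = L' 1 - L' 0 := by
  have := eq_of_exp_const (f := fun s => L s - L' s) (hL.sub hL') (fun s t => by
    rw [Complex.exp_sub, Complex.exp_sub, h, h, mul_div_cancel_right₀ _ (Complex.exp_ne_zero _),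
      mul_div_cancel_right₀ _ (Complex.exp_ne_zero _)]) 1 0
  linear_combination this

/-- The parity computation for five points on a convex pentagon. -/
theorem pentagon_parity (k : Fin 5 → Fin 5 → Fin 5 → ℤ) (s : Fin 5 → Fin 5 → ℤ)
    (hs : ∀ a b, s a b = if b < a then 1 else -1)
    (h : ∀ a b c d : Fin 5, a < b → c < d → a ≠ c → a ≠ d → b ≠ c → b ≠ d →
      s c b + s a c + s b d + s d a + 2 * (k c a b + k b c d - k a c d - k d a b) = 0) : False := by
  have h1 := h 0 1 2 3 (by decide) (by decide) (by decide) (by decide) (by decide) (by decide)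
  have h2 := h 0 1 2 4 (by decide) (by decide) (by decide) (by decide) (by decide) (by decide)
  have h3 := h 0 1 3 4 (by decide) (by decide) (by decide) (by decide) (by decide) (by decide)
  have h4 := h 0 2 1 3 (by decide) (by decide) (by decide) (by decide) (by decide) (by decide)
  have h5 := h 0 2 1 4 (by decide) (by decide) (by decide) (by decide) (by decide) (by decide)
  have h6 := h 0 2 3 4 (by decide) (by decide) (by decide) (by decide) (by decide) (by decide)
  have h7 := h 0 3 1 2 (by decide) (by decide) (by decide) (by decide) (by decide) (by decide)
  have h8 := h 0 3 1 4 (by decide) (by decide) (by decide) (by decide) (by decide) (by decide)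
  have h9 := h 0 3 2 4 (by decide) (by decide) (by decide) (by decide) (by decide) (by decide)
  have h10 := h 0 4 1 2 (by decide) (by decide) (by decide) (by decide) (by decide) (by decide)
  have h11 := h 0 4 1 3 (by decide) (by decide) (by decide) (by decide) (by decide) (by decide)
  have h12 := h 0 4 2 3 (by decide) (by decide) (by decide) (by decide) (by decide) (by decide)
  have h13 := h 1 2 3 4 (by decide) (by decide) (by decide) (by decide) (by decide) (by decide)
  have h14 := h 1 3 2 4 (by decide) (by decide) (by decide) (by decide) (by decide) (by decide)
  have h15 := h 1 4 2 3 (by decide) (by decide) (by decide) (by decide) (by decide) (by decide)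
  -- In the 15 equations each integer `k v a b` occurs exactly twice: the edge ab is paired with vw
  -- for the two remaining vertices w. The sign part is -2 for the five pairs of crossing chords of
  -- the pentagon and 0 for the others. After halving and summing, an odd number equals an even one.
  simp [hs] at h1 h2 h3 h4 h5 h6 h7 h8 h9 h10 h11 h12 h13 h14 h15
  omega

/-- For independent edges ab and cd the function (s, t) ↦ g_ab(s) - g_cd(t) has a continuous
logarithm. Its increments along the four sides of the unit square are the increments `δ v e` of
log(g_e - p v), for an edge e and a vertex v off e. Up to integer multiples `k v e` of 2πi these are
determined by the positions of the vertices. Closing up around the square gives the equations of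
`pentagon_parity`. -/
theorem not_weaklyDrawable_K5 : ¬ WeaklyDrawable (⊤ : SimpleGraph (Fin 5)) := by
  rintro ⟨p, S, hj, hd⟩
  simp only [SimpleGraph.top_adj] at hj hd
  choose γ hγ using hj
  have hp : ∀ a b, a ≠ b → p a - p b ≠ 0 := by
    intro a b hab
    -- Different vertices have different images, as they lie on independent edges ac and bd.
    obtain ⟨c, d, h1, h2, h3, h4, h5⟩ : ∃ c d : Fin 5, a ≠ c ∧ b ≠ d ∧ a ≠ d ∧ c ≠ b ∧ c ≠ d := by
      revert a b; decide
    intro h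
    rw [sub_eq_zero] at h
    have ha : p a ∈ S s(a, c) := by simpa using hγ a c h1 0
    have hb : p b ∈ S s(b, d) := by simpa using hγ b d h2 0
    exact Set.disjoint_left.1 (hd a c b d h1 h2 hab h3 h4 h5) ha (h ▸ hb)
  -- the curves, defined on the whole line
  let g : ∀ a b : Fin 5, a ≠ b → ℝ → ℂ := fun a b h => (γ a b h).extend
  have hgc : ∀ a b h, Continuous (g a b h) := fun a b h => (γ a b h).continuous_extend
  have hg0 : ∀ a b h, g a b h 0 = p a := fun a b h => (γ a b h).extend_zero
  have hg1 : ∀ a b h, g a b h 1 = p b := fun a b h => (γ a b h).extend_one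
  have hgS : ∀ a b h t, g a b h t ∈ S s(a, b) := fun a b h t => hγ a b h _
  have hne : ∀ a b c d hab hcd, a ≠ c → a ≠ d → b ≠ c → b ≠ d → ∀ s t,
      g a b hab s - g c d hcd t ≠ 0 := by
    intro a b c d hab hcd h1 h2 h3 h4 s t h
    rw [sub_eq_zero] at h
    exact Set.disjoint_left.1 (hd a b c d hab hcd h1 h2 h3 h4) (hgS a b hab s)
      (h ▸ hgS c d hcd t)
  have hnep : ∀ a b v hab, a ≠ v → b ≠ v → ∀ s, g a b hab s - p v ≠ 0 := by
    intro a b v hab h1 h2 s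
    obtain ⟨d, h3, h4, h5⟩ : ∃ d : Fin 5, v ≠ d ∧ a ≠ d ∧ b ≠ d := by
      revert a b v; decide
    have := hne a b v d hab h3 h1 h4 h2 h5 s 0
    rwa [hg0] at this
  -- the change of the logarithm of `g a b - p v`
  have hΔ : ∀ v a b : Fin 5, ∃ δ : ℂ, ∀ hab : a ≠ b, a ≠ v → b ≠ v →
      (Complex.exp δ = (p b - p v) / (p a - p v)) ∧
      ∀ (L : ℝ → ℂ) (κ : ℂ), Continuous L →
        (∀ s, Complex.exp (L s) = κ * (g a b hab s - p v)) → L 1 - L 0 = δ := by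
    intro v a b
    by_cases hab : a ≠ b ∧ a ≠ v ∧ b ≠ v
    · obtain ⟨hab, h1, h2⟩ := hab
      obtain ⟨L, hL, hLe⟩ := exists_continuous_log (f := fun s => g a b hab s - p v)
        ((hgc a b hab).sub continuous_const) (hnep a b v hab h1 h2)
      refine ⟨L 1 - L 0, fun _ _ _ => ⟨?_, fun L' κ hL' h => ?_⟩⟩
      · rw [Complex.exp_sub, hLe, hLe, hg0, hg1]
      · exact log_increment_eq hL' hL κ fun s => by rw [h, hLe]
    · exact ⟨0, fun h1 h2 h3 => (hab ⟨h1, h2, h3⟩).elim⟩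
  choose δ hδ using hΔ
  -- One logarithm is fixed for each unordered pair, and the reversed difference gets πi added. So
  -- `φ a b - φ b a` is exactly ±πi, which produces the signs `s`.
  let φ : Fin 5 → Fin 5 → ℂ := fun v w =>
    if v < w then Complex.log (p w - p v) else Complex.log (p v - p w) + Real.pi * Complex.I
  have hφ : ∀ v w, v ≠ w → Complex.exp (φ v w) = p w - p v := by
    intro v w h
    dsimp only [φ]
    split_ifs
    · exact Complex.exp_log (hp _ _ h.symm)
    · rw [Complex.exp_add, Complex.exp_log (hp _ _ h), Complex.exp_pi_mul_I]; ring
  have hk : ∀ v a b : Fin 5, ∃ k : ℤ, a ≠ b → a ≠ v → b ≠ v →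
      δ v a b = φ v b - φ v a + k * (2 * Real.pi * Complex.I) := by
    intro v a b
    by_cases hab : a ≠ b ∧ a ≠ v ∧ b ≠ v
    · obtain ⟨hab, h1, h2⟩ := hab
      have := (hδ v a b hab h1 h2).1
      rw [← hφ v b h2.symm, ← hφ v a h1.symm, ← Complex.exp_sub] at this
      obtain ⟨k, hk⟩ := Complex.exp_eq_exp_iff_exists_int.1 this
      exact ⟨k, fun _ _ _ => hk⟩
    · exact ⟨0, fun h1 h2 h3 => (hab ⟨h1, h2, h3⟩).elim⟩
  choose k hk using hk
  let s : Fin 5 → Fin 5 → ℤ := fun a b => if b < a then 1 else -1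
  have hs : ∀ a b, a ≠ b → φ a b - φ b a = Real.pi * Complex.I * s a b := by
    intro a b hab
    rcases lt_or_gt_of_ne hab with h | h
    · simp only [φ, s, if_pos h, if_neg h.asymm]; push_cast; ring
    · simp only [φ, s, if_pos h, if_neg h.asymm]; push_cast; ring
  refine pentagon_parity k s (fun _ _ => rfl) fun a b c d hab hcd hac had hbc hbd => ?_
  obtain ⟨L, hL, hLe⟩ := exists_continuous_log
    (f := fun x : ℝ × ℝ => g a b hab.ne x.1 - g c d hcd.ne x.2)
    (((hgc _ _ _).comp continuous_fst).sub ((hgc _ _ _).comp continuous_snd))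
    (fun x => hne a b c d hab.ne hcd.ne hac had hbc hbd _ _)
  have e1 := (hδ c a b hab.ne hac hbc).2 (fun s => L (s, 0)) 1 (by fun_prop)
    (fun s => by rw [hLe, hg0, one_mul])
  have e2 := (hδ d a b hab.ne had hbd).2 (fun s => L (s, 1)) 1 (by fun_prop)
    (fun s => by rw [hLe, hg1, one_mul])
  have e3 := (hδ a c d hcd.ne hac.symm had.symm).2 (fun s => L (0, s)) (-1) (by fun_prop)
    (fun s => by rw [hLe, hg0]; ring)
  have e4 := (hδ b c d hcd.ne hbc.symm hbd.symm).2 (fun s => L (1, s)) (-1) (by fun_prop)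
    (fun s => by rw [hLe, hg1]; ring)
  rw [hk c a b hab.ne hac hbc] at e1
  rw [hk d a b hab.ne had hbd] at e2
  rw [hk a c d hcd.ne hac.symm had.symm] at e3
  rw [hk b c d hcd.ne hbc.symm hbd.symm] at e4
  have s1 := hs c b hbc.symm
  have s2 := hs a c hac
  have s3 := hs b d hbd
  have s4 := hs d a had.symm
  have hpi : (Real.pi * Complex.I : ℂ) ≠ 0 := by
    simp [Real.pi_ne_zero]
  have : ((s c b + s a c + s b d + s d a + 2 * (k c a b + k b c d - k a c d - k d a b) : ℤ) : ℂ)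
      = 0 := by
    apply mul_left_cancel₀ hpi
    push_cast
    -- The values of `L` at the four corners cancel.
    linear_combination -e1 + e2 + e3 - e4 - s1 - s2 - s3 - s4
  exact_mod_cast this

end SuperHierarchy

namespace SuperHierarchy

/-! ## Many edges force a complete minor -/

section Mader

open Finset
open scoped Classical in
/-- The number of neighbours of `a` in `A`. -/
noncomputable def degIn {V : Type*} (G : SimpleGraph V) (A : Finset V) (a : V) : ℕ :=
  #{b ∈ A | G.Adj a b}

/-- Twice the number of edges inside `A`. -/
noncomputable def arcsIn {V : Type*} (G : SimpleGraph V) (A : Finset V) : ℕ :=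
  ∑ a ∈ A, degIn G A a

open scoped Classical in
/-- The neighbours of `X` in `A` outside `X`. -/
noncomputable def nbrsIn {V : Type*} (G : SimpleGraph V) (A X : Finset V) : Finset V :=
  {b ∈ A \ X | ∃ a ∈ X, G.Adj a b}

variable {V : Type*} (G : SimpleGraph V)

theorem degIn_insert [DecidableEq V] {A : Finset V} {v : V} (hv : v ∉ A) (a : V)
    [Decidable (G.Adj a v)] :
    degIn G (insert v A) a = degIn G A a + if G.Adj a v then 1 else 0 := by
  classical
  unfold degIn
  rw [filter_insert]
  split_ifs
  · rw [card_insert_of_notMem (by simp [hv])]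
  · rfl

theorem arcsIn_insert [DecidableEq V] {A : Finset V} {v : V} (hv : v ∉ A) :
    arcsIn G (insert v A) = arcsIn G A + 2 * degIn G A v := by
  classical
  unfold arcsIn
  rw [sum_insert hv, degIn_insert G hv, if_neg (G.loopless.irrefl v)]
  simp_rw [degIn_insert G hv]
  rw [sum_add_distrib, ← card_filter]
  have : #{x ∈ A | G.Adj x v} = degIn G A v := by
    unfold degIn; congr 1; ext; simp [G.adj_comm]
  rw [this]; omega

theorem ConnectedIn.insert {G : SimpleGraph V} {X : Set V} {v u : V} (hX : ConnectedIn G X)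
    (hu : u ∈ X) (huv : G.Adj u v) : ConnectedIn G (insert v X) := by
  have hmono : ∀ a ∈ X, ∀ b ∈ X, Relation.ReflTransGen
      (fun x y => G.Adj x y ∧ x ∈ Insert.insert v X ∧ y ∈ Insert.insert v X) a b :=
    fun a ha b hb => Relation.ReflTransGen.mono
      (fun x y h => ⟨h.1, Or.inr h.2.1, Or.inr h.2.2⟩) _ _ (hX a ha b hb)
  rintro a (rfl | ha) b (rfl | hb)
  · exact .refl
  · exact .head ⟨huv.symm, Or.inl rfl, Or.inr hu⟩ (hmono _ hu _ hb)
  · exact .tail (hmono _ ha _ hu) ⟨huv, Or.inr hu, Or.inl rfl⟩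
  · exact hmono _ ha _ hb

/-- Mader's argument: contract a maximal connected set X for which the contracted graph still has at
least c = 2^(t+1) arcs per vertex. By maximality every neighbour of X has at least 2^t neighbours
inside N(X). The induction hypothesis gives t branch sets inside N(X), and X, adjacent to all of
N(X), is the last one. -/
theorem exists_completeModel (t : ℕ) : ∀ A : Finset V, A.Nonempty → 2 ^ t * #A ≤ arcsIn G A →
    ∃ B : Fin t → Set V, IsMinorModel ⊤ G B ∧ ∀ i, (B i).Nonempty ∧ B i ⊆ A := by
  classical
  induction t with
  | zero => exact fun A _ _ => ⟨fun i => i.elim0, ⟨fun i => i.elim0, fun i => i.elim0,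
      fun i => i.elim0⟩, fun i => i.elim0⟩
  | succ t iht =>
    intro A
    induction hn : #A using Nat.strong_induction_on generalizing A with
    | _ n ihn =>
    subst hn
    intro hA hE
    let c := 2 ^ (t + 1)
    -- Contracting X leaves `#(A \ X) + 1` vertices, and an edge to the new vertex for each member
    -- of `nbrsIn G A X`, counted twice among the arcs. For a singleton the condition is the
    -- hypothesis on A.
    let F : Finset (Finset V) := {X ∈ A.powerset | X.Nonempty ∧ ConnectedIn G (X : Set V) ∧
      c * (#(A \ X) + 1) ≤ arcsIn G (A \ X) + 2 * #(nbrsIn G A X)}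
    have hF : F.Nonempty := by
      obtain ⟨v, hv⟩ := hA
      refine ⟨{v}, ?_⟩
      simp only [F, mem_filter, mem_powerset, singleton_subset_iff]
      refine ⟨hv, singleton_nonempty v, ?_, ?_⟩
      · intro a ha b hb
        simp only [coe_singleton, Set.mem_singleton_iff] at ha hb
        rw [ha, hb]
      · have h1 : insert v (A \ {v}) = A := by ext x; by_cases hx : x = v <;> simp_all
        have h2 := arcsIn_insert G (A := A \ {v}) (v := v) (by simp)
        have h3 : #(nbrsIn G A {v}) = degIn G (A \ {v}) v := by
          unfold nbrsIn degIn; congr 1; ext; simp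
        have h4 : #(A \ {v}) + 1 = #A := by
          rw [← h1, card_insert_of_notMem (by simp), h1]
        rw [h1] at h2
        rw [h3, h4, ← h2]; exact hE
    obtain ⟨X, hXF, hmax⟩ := F.exists_max_image card hF
    simp only [F, mem_filter, mem_powerset] at hXF hmax
    obtain ⟨hXA, hXn, hXc, hXE⟩ := hXF
    have hcpos : 0 < c := by positivity
    rcases (nbrsIn G A X).eq_empty_or_nonempty with hN | hN
    -- If X has no neighbours in A, then `A \ X` is smaller and satisfies the hypothesis by itself;
    -- it is nonempty because c > 0.
    · rw [hN, card_empty, mul_zero, add_zero] at hXE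
      have hlt : #(A \ X) < #A := card_lt_card (sdiff_ssubset hXA hXn)
      have hne : (A \ X).Nonempty := by
        rw [nonempty_iff_ne_empty]
        intro h
        rw [h] at hXE
        simp only [arcsIn, card_empty, sum_empty] at hXE
        omega
      obtain ⟨B, hB, hB'⟩ := ihn _ hlt (A \ X) rfl hne (le_trans (Nat.mul_le_mul le_rfl
        (Nat.le_succ _)) hXE)
      exact ⟨B, hB, fun i => ⟨(hB' i).1, (hB' i).2.trans (by simp)⟩⟩
    · have hdeg : ∀ v ∈ nbrsIn G A X, 2 ^ t ≤ degIn G (nbrsIn G A X) v := by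
        intro v hv
        by_contra hlt
        have hv' := hv
        simp only [nbrsIn, mem_filter, mem_sdiff] at hv'
        obtain ⟨⟨hvA, hvX⟩, u, hu, huv⟩ := hv'
        have hsplit : A \ X = insert v (A \ insert v X) := by ext x; by_cases hx : x = v <;> simp_all
        have hvn : v ∉ A \ insert v X := by simp
        have h1 := arcsIn_insert G hvn
        have h2 : #(A \ X) = #(A \ insert v X) + 1 := by
          rw [hsplit, card_insert_of_notMem hvn]
        rw [← hsplit] at h1
        -- Absorbing v into X loses the edge from X to v and one edge for each common neighbour.
        -- Hence if v had fewer than 2^t neighbours in N(X), at most 2 · 2^t = c arcs would be lost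
        -- together with one vertex, and the larger set would still belong to `F`.
        have h3 : #(nbrsIn G A X) + degIn G (A \ insert v X) v ≤
            #(nbrsIn G A (insert v X)) + 1 + degIn G (nbrsIn G A X) v := by
          unfold degIn
          rw [← card_union_add_card_inter]
          apply Nat.add_le_add
          · rw [← card_insert_of_notMem (s := nbrsIn G A (insert v X)) (a := v)
              (by simp [nbrsIn])]
            apply card_le_card
            intro x
            simp only [nbrsIn, mem_union, mem_filter, mem_sdiff, mem_insert]
            rintro (⟨⟨h1, h2⟩, b, hb, hbx⟩ | ⟨⟨h1, h2⟩, h3⟩)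
            · rcases eq_or_ne x v with rfl | hxv
              · exact Or.inl rfl
              · exact Or.inr ⟨⟨h1, by tauto⟩, b, Or.inr hb, hbx⟩
            · exact Or.inr ⟨⟨h1, h2⟩, v, Or.inl rfl, h3⟩
          · apply card_le_card
            intro x
            simp only [mem_inter, mem_filter]
            exact fun h => ⟨h.1, h.2.2⟩
        have h4 : ¬ #(insert v X) ≤ #X := by
          rw [card_insert_of_notMem hvX]; omega
        apply h4
        apply hmax
        refine ⟨insert_subset hvA hXA, insert_nonempty _ _, ?_, ?_⟩
        · rw [coe_insert]; exact hXc.insert hu huv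
        · have h5 : c = 2 * 2 ^ t := by simp only [c]; ring
          rw [h2] at hXE
          have h6 : c * (#(A \ insert v X) + 1 + 1) = c * (#(A \ insert v X) + 1) + c := by ring
          omega
      obtain ⟨B, hB, hB'⟩ := iht (nbrsIn G A X) hN (by
        unfold arcsIn
        rw [mul_comm, ← smul_eq_mul]
        exact card_nsmul_le_sum _ _ _ hdeg)
      have hBX : ∀ i v, v ∈ B i → v ∈ A ∧ v ∉ X ∧ ∃ a ∈ X, G.Adj a v := by
        intro i v hv
        have := (hB' i).2 hv
        simpa [nbrsIn, and_assoc] using this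
      refine ⟨Fin.cons (X : Set V) B, ⟨?_, ?_, ?_⟩, ?_⟩
      · intro x y v
        refine Fin.cases ?_ (fun i => ?_) x <;> refine Fin.cases ?_ (fun j => ?_) y
        · simp
        · intro h1 h2; exact ((hBX j v (by simpa using h2)).2.1 (by simpa using h1)).elim
        · intro h1 h2; exact ((hBX i v (by simpa using h1)).2.1 (by simpa using h2)).elim
        · intro h1 h2
          rw [hB.disjoint i j v (by simpa using h1) (by simpa using h2)]
      · intro x
        refine Fin.cases ?_ (fun i => ?_) x
        · exact hXc
        · exact hB.connected i
      · intro x y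
        refine Fin.cases ?_ (fun i => ?_) x <;> refine Fin.cases ?_ (fun j => ?_) y
        · simp
        · intro _
          obtain ⟨b, hb⟩ := (hB' j).1
          obtain ⟨a, ha, hab⟩ := (hBX j b hb).2.2
          exact ⟨a, by simpa using ha, b, by simpa using hb, hab⟩
        · intro _
          obtain ⟨b, hb⟩ := (hB' i).1
          obtain ⟨a, ha, hab⟩ := (hBX i b hb).2.2
          exact ⟨b, by simpa using hb, a, by simpa using ha, hab.symm⟩
        · intro h
          obtain ⟨a, ha, b, hb, hab⟩ := hB.adj i j (by simpa using h)
          exact ⟨a, by simpa using ha, b, by simpa using hb, hab⟩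
      · intro x
        refine Fin.cases ?_ (fun i => ?_) x
        · exact ⟨by simpa using hXn, by simpa using hXA⟩
        · exact ⟨(hB' i).1, fun v hv => (hBX i v (by simpa using hv)).1⟩

end Mader

/-- The constant is 2^5, for a K₅ minor. -/
theorem WeaklyDrawable.arcsIn_le {V : Type*} {G : SimpleGraph V} (hG : WeaklyDrawable G)
    (A : Finset V) : arcsIn G A ≤ 32 * A.card := by
  rcases A.eq_empty_or_nonempty with rfl | hA
  · simp [arcsIn]
  · by_contra h
    obtain ⟨B, hB, -⟩ := exists_completeModel G 5 A hA (by omega)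
    exact not_weaklyDrawable_K5 (hG.of_minor hB)

end SuperHierarchy

namespace SuperHierarchy

open Reg Arr WArr Exp Test Cmd

/-! ## Running times of programs -/

/-- The program `c`, started with memory `σ`, halts within `K` steps, and then `Q` holds. -/
def Runs (c : Cmd) (σ : Store) (K : ℕ) (Q : Store → Prop) : Prop :=
  ∃ t τ, Exec c σ t τ ∧ t ≤ K ∧ Q τ

theorem Runs.mono {c : Cmd} {σ : Store} {K L : ℕ} {P Q : Store → Prop} (h : Runs c σ K P)
    (hKL : K ≤ L) (hPQ : ∀ τ, P τ → Q τ) : Runs c σ L Q := by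
  obtain ⟨t, τ, h1, h2, h3⟩ := h
  exact ⟨t, τ, h1, h2.trans hKL, hPQ _ h3⟩

theorem Runs.seq {c d : Cmd} {σ : Store} {K L : ℕ} {Q : Store → Prop}
    (h : Runs c σ K fun τ => Runs d τ L Q) : Runs (c ;; d) σ (K + L) Q := by
  obtain ⟨t, τ, h1, h2, t', υ, h3, h4, h5⟩ := h
  exact ⟨t + t', υ, .seq h1 h3, add_le_add h2 h4, h5⟩

/-- The registers that a program may change. -/
def Cmd.writesReg : Cmd → Reg → Bool
  | .skip, _ => false
  | .set r _, r' => decide (r = r')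
  | .put _ _ _, _ => false
  | .wput _ _ _ _, _ => false
  | .seq c d, r => c.writesReg r || d.writesReg r
  | .ite _ c d, r => c.writesReg r || d.writesReg r
  | .loop _ c, r => c.writesReg r

/-- The integer arrays that a program may change. -/
def Cmd.writesArr : Cmd → Arr → Bool
  | .skip, _ => false
  | .set _ _, _ => false
  | .put a _ _, a' => decide (a = a')
  | .wput _ _ _ _, _ => false
  | .seq c d, a => c.writesArr a || d.writesArr a
  | .ite _ c d, a => c.writesArr a || d.writesArr a
  | .loop _ c, a => c.writesArr a

/-- The memories `σ` and `τ` agree on everything that `c` does not change, weights excepted. -/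
structure Agree (c : Cmd) (σ τ : Store) : Prop where
  reg : ∀ r, c.writesReg r = false → τ.reg r = σ.reg r
  arr : ∀ a, c.writesArr a = false → τ.arr a = σ.arr a

@[simp] theorem Store.setReg_reg_self (σ : Store) (r : Reg) (v : ℕ) :
    (σ.setReg r v).reg r = v := by simp [Store.setReg]
@[simp] theorem Store.setReg_reg_of_ne (σ : Store) {r r' : Reg} (v : ℕ) (h : r' ≠ r) :
    (σ.setReg r v).reg r' = σ.reg r' := by simp [Store.setReg, h]
@[simp] theorem Store.setReg_arr (σ : Store) (r : Reg) (v : ℕ) : (σ.setReg r v).arr = σ.arr := rfl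
@[simp] theorem Store.setArr_reg (σ : Store) (a : Arr) (i v : ℕ) :
    (σ.setArr a i v).reg = σ.reg := rfl
@[simp] theorem Store.setArr_arr_self (σ : Store) (a : Arr) (i v : ℕ) :
    (σ.setArr a i v).arr a = Function.update (σ.arr a) i v := by simp [Store.setArr]
@[simp] theorem Store.setArr_arr_of_ne (σ : Store) {a a' : Arr} (i v : ℕ) (h : a' ≠ a) :
    (σ.setArr a i v).arr a' = σ.arr a' := by simp [Store.setArr, h]
@[simp] theorem Store.setWt_arr (σ : Store) (a : WArr) (i : ℕ) (v : ℝ) :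
    (σ.setWt a i v).arr = σ.arr := rfl
@[simp] theorem Exp.eval_sub (σ : Store) (s t : Exp) : (s - t).eval σ = s.eval σ - t.eval σ := rfl
attribute [simp] Exp.eval Test.Holds

/-- The frame condition is proved once for all programs. Since `writesReg` and `writesArr` are
computable, the survival of a particular register or array is afterwards settled by `rfl`. -/
theorem Exec.agree {c : Cmd} {σ τ : Store} {t : ℕ} (h : Exec c σ t τ) : Agree c σ τ := by
  induction h with
  | skip | loop_false => exact ⟨fun _ _ => rfl, fun _ _ => rfl⟩
  | set r s σ =>
    refine ⟨fun r' h => ?_, fun _ _ => rfl⟩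
    have : r ≠ r' := by simpa [Cmd.writesReg] using h
    simp [this.symm]
  | put a s t σ =>
    refine ⟨fun _ _ => rfl, fun a' h => ?_⟩
    have : a ≠ a' := by simpa [Cmd.writesArr] using h
    simp [this.symm]
  | wput => exact ⟨fun _ _ => rfl, fun _ _ => rfl⟩
  | seq _ _ ih₁ ih₂ =>
    refine ⟨fun r h => ?_, fun a h => ?_⟩
    · simp only [Cmd.writesReg, Bool.or_eq_false_iff] at h
      rw [ih₂.reg r h.2, ih₁.reg r h.1]
    · simp only [Cmd.writesArr, Bool.or_eq_false_iff] at h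
      rw [ih₂.arr a h.2, ih₁.arr a h.1]
  | ite_true _ _ ih =>
    refine ⟨fun r h => ih.reg r ?_, fun a h => ih.arr a ?_⟩
    · simp only [Cmd.writesReg, Bool.or_eq_false_iff] at h; exact h.1
    · simp only [Cmd.writesArr, Bool.or_eq_false_iff] at h; exact h.1
  | ite_false _ _ ih =>
    refine ⟨fun r h => ih.reg r ?_, fun a h => ih.arr a ?_⟩
    · simp only [Cmd.writesReg, Bool.or_eq_false_iff] at h; exact h.2
    · simp only [Cmd.writesArr, Bool.or_eq_false_iff] at h; exact h.2
  | loop_true _ _ _ ih₁ ih₂ =>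
    exact ⟨fun r h => by rw [ih₂.reg r h, ih₁.reg r h], fun a h => by rw [ih₂.arr a h, ih₁.arr a h]⟩

theorem Runs.agree {c : Cmd} {σ : Store} {K : ℕ} {Q : Store → Prop} (h : Runs c σ K Q) :
    Runs c σ K fun τ => Agree c σ τ ∧ Q τ := by
  obtain ⟨t, τ, h1, h2, h3⟩ := h
  exact ⟨t, τ, h1, h2, h1.agree, h3⟩

theorem Runs.seq_agree {c d : Cmd} {σ : Store} {K L : ℕ} {P Q : Store → Prop}
    (h : Runs c σ K P) (h' : ∀ τ, Agree c σ τ → P τ → Runs d τ L Q) :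
    Runs (c ;; d) σ (K + L) Q :=
  .seq (h.agree.mono le_rfl fun τ hτ => h' τ hτ.1 hτ.2)

/-! ### Programs without loops -/

/-- The weakest precondition of a program without loops. -/
def Cmd.wp : Cmd → (Store → Prop) → Store → Prop
  | .skip, Q, σ => Q σ
  | .set r s, Q, σ => Q (σ.setReg r (s.eval σ))
  | .put a s t, Q, σ => Q (σ.setArr a (s.eval σ) (t.eval σ))
  | .wput a s b t, Q, σ => Q (σ.setWt a (s.eval σ) (σ.wt b (t.eval σ)))
  | .seq c d, Q, σ => c.wp (d.wp Q) σ
  | .ite p c d, Q, σ => (p.Holds σ → c.wp Q σ) ∧ (¬ p.Holds σ → d.wp Q σ)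
  -- With the precondition `False` for loops, `Runs.of_wp_le` is vacuous for them, so the value 0 of
  -- `Cmd.wc` on loops does no harm.
  | .loop _ _, _, _ => False

attribute [simp] Cmd.wp

/-- A bound for the running time of a program without loops. -/
def Cmd.wc : Cmd → ℕ
  | .skip => 1
  | .set _ s => s.cost + 1
  | .put _ s t => s.cost + t.cost + 1
  | .wput _ s _ t => s.cost + t.cost + 2
  | .seq c d => c.wc + d.wc
  | .ite p c d => p.cost + 1 + max c.wc d.wc
  | .loop _ _ => 0

theorem Runs.of_wp_le {c : Cmd} : ∀ {σ : Store} {Q : Store → Prop}, c.wp Q σ →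
    Runs c σ c.wc Q := by
  induction c with
  | skip => exact fun h => ⟨_, _, .skip _, le_rfl, h⟩
  | set r s => exact fun h => ⟨_, _, .set _ _ _, le_rfl, h⟩
  | put a s t => exact fun h => ⟨_, _, .put _ _ _ _, le_rfl, h⟩
  | wput a s b t => exact fun h => ⟨_, _, .wput _ _ _ _ _, le_rfl, h⟩
  | seq c d ihc ihd => exact fun h => .seq ((ihc h).mono le_rfl fun τ hτ => ihd hτ)
  | ite p c d ihc ihd =>
    intro σ Q h
    by_cases hp : p.Holds σ
    · obtain ⟨t, τ, h1, h2, h3⟩ := ihc (h.1 hp)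
      exact ⟨_, τ, .ite_true hp h1, by simp only [Cmd.wc]; omega, h3⟩
    · obtain ⟨t, τ, h1, h2, h3⟩ := ihd (h.2 hp)
      exact ⟨_, τ, .ite_false hp h1, by simp only [Cmd.wc]; omega, h3⟩
  | loop p c _ => exact fun h => h.elim

theorem Runs.of_wp {c : Cmd} {σ : Store} {K : ℕ} {Q : Store → Prop} (hK : c.wc ≤ K)
    (h : c.wp Q σ) : Runs c σ K Q := (Runs.of_wp_le h).mono hK fun _ h => h

/-! ### Amortised running times and loops -/

/-- The program `c`, started with memory `σ`, halts with amortised running time at most `K` with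
respect to the potential `Φ`, and then `Q` holds. -/
def RunsWith (Φ : Store → ℕ) (c : Cmd) (σ : Store) (K : ℕ) (Q : Store → Prop) : Prop :=
  ∃ t τ, Exec c σ t τ ∧ t + Φ τ ≤ K + Φ σ ∧ Q τ

theorem RunsWith.seq {Φ : Store → ℕ} {c d : Cmd} {σ : Store} {K L : ℕ} {P Q : Store → Prop}
    (h : RunsWith Φ c σ K P) (h' : ∀ τ, Agree c σ τ → P τ → RunsWith Φ d τ L Q) :
    RunsWith Φ (c ;; d) σ (K + L) Q := by
  obtain ⟨t, τ, h1, h2, h3⟩ := h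
  obtain ⟨t', υ, h4, h5, h6⟩ := h' τ h1.agree h3
  exact ⟨t + t', υ, .seq h1 h4, by omega, h6⟩

/-- A step that raises the potential by at most `D` is charged `D` in addition to its actual cost.
-/
theorem Runs.runsWith {Φ : Store → ℕ} {c : Cmd} {σ : Store} {K D L : ℕ} {Q : Store → Prop}
    (h : Runs c σ K fun τ => Φ τ ≤ D + Φ σ ∧ Q τ) (hL : K + D ≤ L) : RunsWith Φ c σ L Q := by
  obtain ⟨t, τ, h1, h2, h3, h4⟩ := h
  exact ⟨t, τ, h1, by omega, h4⟩

theorem RunsWith.ite {Φ : Store → ℕ} {p : Test} {c d : Cmd} {σ : Store} {K L : ℕ}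
    {Q : Store → Prop} (hc : p.Holds σ → RunsWith Φ c σ K Q)
    (hd : ¬ p.Holds σ → RunsWith Φ d σ K Q) (hL : p.cost + 1 + K ≤ L) :
    RunsWith Φ (.ite p c d) σ L Q := by
  by_cases hp : p.Holds σ
  · obtain ⟨t, τ, h1, h2, h3⟩ := hc hp
    exact ⟨_, τ, .ite_true hp h1, by omega, h3⟩
  · obtain ⟨t, τ, h1, h2, h3⟩ := hd hp
    exact ⟨_, τ, .ite_false hp h1, by omega, h3⟩

/-- The rule for loops: every run of the body decreases the value `μ` and takes at most `K`
steps. -/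
theorem RunsWith.loop {p : Test} {c : Cmd} {K : ℕ} {Inv : Store → Prop} (μ : Store → ℕ)
    (hc : ∀ σ, Inv σ → p.Holds σ → Runs c σ K fun τ => Inv τ ∧ μ τ < μ σ) :
    ∀ σ, Inv σ → RunsWith (fun τ => μ τ * (p.cost + 1 + K)) (.loop p c) σ (p.cost + 1)
      fun τ => Inv τ ∧ ¬ p.Holds τ := by
  suffices h : ∀ n σ, μ σ ≤ n → Inv σ → RunsWith (fun τ => μ τ * (p.cost + 1 + K)) (.loop p c) σ
      (p.cost + 1) fun τ => Inv τ ∧ ¬ p.Holds τ from fun σ => h _ σ le_rfl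
  intro n
  induction n with
  | zero =>
    intro σ hn hσ
    by_cases hp : p.Holds σ
    · obtain ⟨t, τ, h1, h2, h3, h4⟩ := hc σ hσ hp
      omega
    · exact ⟨_, σ, .loop_false hp, le_rfl, hσ, hp⟩
  | succ n ih =>
    intro σ hn hσ
    by_cases hp : p.Holds σ
    · obtain ⟨t, τ, h1, h2, h3, h4⟩ := hc σ hσ hp
      obtain ⟨t', υ, h5, h6, h7⟩ := ih τ (by omega) h3
      refine ⟨_, υ, .loop_true hp h1 h5, ?_, h7⟩
      -- A round costs at most `p.cost + 1 + K`, which the drop of `μ` by at least one releases.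
      -- Only the final failing test remains to be paid.
      have : (μ τ + 1) * (p.cost + 1 + K) ≤ μ σ * (p.cost + 1 + K) := Nat.mul_le_mul_right _ h4
      rw [Nat.add_mul] at this
      dsimp only at h6 ⊢
      omega
    · exact ⟨_, σ, .loop_false hp, le_rfl, hσ, hp⟩

/-- A round consists of the test and branch (`bound.cost + 3`), the body (`K`) and the increment of
the counter (4). The additional round in `N + 1` pays for the initialisation and the last test. The
invariant is required after the increment, whence `setReg` in the hypothesis on the body. -/
theorem RunsWith.forLoop {Φ : Store → ℕ} {r : Reg} {bound : Exp} {c : Cmd} {σ : Store} {K : ℕ} (N : ℕ)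
    (Inv : ℕ → Store → Prop) (hr : c.writesReg r = false)
    (hΦ : ∀ τ v, Φ (τ.setReg r v) = Φ τ)
    (hN : ∀ τ, Agree (SuperHierarchy.forLoop r bound c) σ τ → bound.eval τ = N)
    (h0 : Inv 0 (σ.setReg r 0))
    (hc : ∀ k < N, ∀ τ, Agree (SuperHierarchy.forLoop r bound c) σ τ → τ.reg r = k → Inv k τ →
      RunsWith Φ c τ K fun υ => Inv (k + 1) (υ.setReg r (k + 1))) :
    RunsWith Φ (SuperHierarchy.forLoop r bound c) σ ((N + 1) * (K + bound.cost + 7))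
      fun τ => Agree (SuperHierarchy.forLoop r bound c) σ τ ∧ Inv N τ := by
  have hloop : ∀ n k τ, n + k = N → Agree (SuperHierarchy.forLoop r bound c) σ τ → τ.reg r = k →
      Inv k τ → ∃ t υ, Exec (.loop (lt r bound) (c ;; .set r (r + 1))) τ t υ ∧
        t + Φ υ ≤ n * (K + bound.cost + 7) + (bound.cost + 3) + Φ τ ∧ Inv N υ := by
    intro n
    induction n with
    | zero =>
      intro k τ hk hA hkr hI
      refine ⟨_, τ, .loop_false ?_, ?_, by rw [← hk, zero_add]; exact hI⟩
      · have := hN τ hA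
        simp only [Test.Holds, Exp.eval]; omega
      · simp only [Test.cost, Exp.cost]; omega
    | succ n ih =>
      intro k τ hk hA hkr hI
      obtain ⟨t, υ, h1, h2, h3⟩ := hc k (by omega) τ hA hkr hI
      have hB := h1.agree
      have hυr : υ.reg r = k := by rw [hB.reg r hr, hkr]
      obtain ⟨t', φ, h4, h5, h6⟩ := ih (k + 1) (υ.setReg r (k + 1)) (by omega)
        ⟨fun r' h' => by
          have h := h'
          simp only [SuperHierarchy.forLoop, Cmd.writesReg, Bool.or_eq_false_iff,
            decide_eq_false_iff_not] at h
          rw [Store.setReg_reg_of_ne _ _ (Ne.symm h.1), hB.reg r' h.2.1, hA.reg r' h'],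
         fun a' h' => by
          have h := h'
          simp only [SuperHierarchy.forLoop, Cmd.writesArr, Bool.or_eq_false_iff] at h
          rw [Store.setReg_arr, hB.arr a' h.2.1, hA.arr a' h']⟩ (by simp) h3
      rw [hΦ] at h5
      have hυ : (r + 1 : Exp).eval υ = k + 1 := by simp [hυr]
      rw [← hυ] at h4
      refine ⟨_, φ, .loop_true ?_ (.seq h1 (.set _ _ _)) h4, ?_, h6⟩
      · have := hN τ hA
        simp only [Test.Holds, Exp.eval]; omega
      · have : (r + 1 : Exp).cost = 3 := rfl
        rw [this]
        simp only [Test.cost, Exp.cost, Nat.add_mul]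
        omega
  obtain ⟨t, υ, h1, h2, h3⟩ := hloop N 0 (σ.setReg r 0) (by omega)
    ⟨fun r' h => by
      simp only [SuperHierarchy.forLoop, Cmd.writesReg, Bool.or_eq_false_iff,
        decide_eq_false_iff_not] at h
      exact Store.setReg_reg_of_ne _ _ (Ne.symm h.1), fun _ _ => rfl⟩ (by simp) h0
  have hE : Exec (SuperHierarchy.forLoop r bound c) σ _ υ := .seq (.set _ _ _) h1
  refine ⟨_, υ, hE, ?_, hE.agree, h3⟩
  rw [hΦ] at h2
  have : (0 : Exp).cost = 1 := rfl
  rw [this, Nat.add_mul]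
  omega

theorem Runs.forLoop {r : Reg} {bound : Exp} {c : Cmd} {σ : Store} {K : ℕ} (N : ℕ)
    (Inv : ℕ → Store → Prop) (hr : c.writesReg r = false)
    (hN : ∀ τ, Agree (SuperHierarchy.forLoop r bound c) σ τ → bound.eval τ = N)
    (h0 : Inv 0 (σ.setReg r 0))
    (hc : ∀ k < N, ∀ τ, Agree (SuperHierarchy.forLoop r bound c) σ τ → τ.reg r = k → Inv k τ →
      Runs c τ K fun υ => Inv (k + 1) (υ.setReg r (k + 1))) :
    Runs (SuperHierarchy.forLoop r bound c) σ ((N + 1) * (K + bound.cost + 7))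
      fun τ => Agree (SuperHierarchy.forLoop r bound c) σ τ ∧ Inv N τ :=
  RunsWith.forLoop (Φ := fun _ => 0) N Inv hr (fun _ _ => rfl) hN h0 hc

end SuperHierarchy

namespace SuperHierarchy

open Reg Arr WArr Exp Test Cmd

/-! ## Histogram sort -/

theorem Agree.trans {c : Cmd} {σ τ υ : Store} (h : Agree c σ τ) (h' : Agree c τ υ) :
    Agree c σ υ :=
  ⟨fun r hr => (h'.reg r hr).trans (h.reg r hr), fun a ha => (h'.arr a ha).trans (h.arr a ha)⟩

theorem Agree.seq_left {c : Cmd} (d : Cmd) {σ τ : Store} (h : Agree c σ τ) :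
    Agree (c ;; d) σ τ :=
  ⟨fun r hr => h.reg r (by simp only [Cmd.writesReg, Bool.or_eq_false_iff] at hr; exact hr.1),
    fun a ha => h.arr a (by simp only [Cmd.writesArr, Bool.or_eq_false_iff] at ha; exact ha.1)⟩

theorem Agree.seq_right (c : Cmd) {d : Cmd} {σ τ : Store} (h : Agree d σ τ) :
    Agree (c ;; d) σ τ :=
  ⟨fun r hr => h.reg r (by simp only [Cmd.writesReg, Bool.or_eq_false_iff] at hr; exact hr.2),
    fun a ha => h.arr a (by simp only [Cmd.writesArr, Bool.or_eq_false_iff] at ha; exact ha.2)⟩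

/-- The result of a stable histogram sort of the first `L` entries of `a` with keys `k p < R`: the
entry at position `p` moves to position `pos p` of `b`, and `bn v` is the position behind the last
entry with key `v`. -/
structure IsStableSort (k a b bn : ℕ → ℕ) (L R : ℕ) (pos : ℕ → ℕ) : Prop where
  lt : ∀ p < L, pos p < L
  eq : ∀ p < L, b (pos p) = a p
  surj : ∀ q < L, ∃ p < L, pos p = q
  mono : ∀ p < L, ∀ q < L, (k p < k q ∨ k p = k q ∧ p < q) → pos p < pos q
  lt_bin : ∀ v < R, ∀ p < L, pos p < bn v ↔ k p ≤ v
  bin_le : ∀ v < R, bn v ≤ L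

/-! ### Positions of the entries in a stable sort -/

/-- The number of `q < L` with `k q < v`. -/
def countLT (k : ℕ → ℕ) (L v : ℕ) : ℕ := Nat.count (fun q => k q < v) L

/-- The number of `q < L` with `k q = v`. -/
def countEQ (k : ℕ → ℕ) (L v : ℕ) : ℕ := Nat.count (fun q => k q = v) L

theorem countLT_zero (k : ℕ → ℕ) (L : ℕ) : countLT k L 0 = 0 := by
  simp [countLT]

theorem countLT_succ (k : ℕ → ℕ) (L v : ℕ) : countLT k L (v + 1) = countLT k L v + countEQ k L v := by
  unfold countLT countEQ
  induction L with
  | zero => rfl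
  | succ L ih =>
    simp only [Nat.count_succ, ih]
    split_ifs <;> omega

theorem countEQ_succ (k : ℕ → ℕ) (i v : ℕ) :
    countEQ k (i + 1) v = countEQ k i v + if k i = v then 1 else 0 := Nat.count_succ _ _

theorem countLT_mono (k : ℕ → ℕ) (L : ℕ) {v w : ℕ} (h : v ≤ w) : countLT k L v ≤ countLT k L w :=
  Nat.count_mono_left fun _ _ hk => lt_of_lt_of_le hk h

theorem countLT_le (k : ℕ → ℕ) (L v : ℕ) : countLT k L v ≤ L := Nat.count_le _

theorem countEQ_lt (k : ℕ → ℕ) {p L : ℕ} (h : p < L) : countEQ k p (k p) < countEQ k L (k p) :=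
  Nat.count_strict_mono rfl h

/-- The position of the entry `p` after sorting. -/
def sortPos (k : ℕ → ℕ) (L p : ℕ) : ℕ := countLT k L (k p) + countEQ k p (k p)

theorem sortPos_lt_countLT (k : ℕ → ℕ) {L p : ℕ} (hp : p < L) :
    sortPos k L p < countLT k L (k p + 1) := by
  rw [countLT_succ]; exact Nat.add_lt_add_left (countEQ_lt k hp) _

theorem sortPos_lt_sortPos (k : ℕ → ℕ) {L p q : ℕ} (hp : p < L)
    (h : k p < k q ∨ k p = k q ∧ p < q) : sortPos k L p < sortPos k L q := by
  rcases h with h | ⟨h, hpq⟩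
  · exact (sortPos_lt_countLT k hp).trans_le ((countLT_mono k L h).trans (Nat.le_add_right _ _))
  · unfold sortPos
    rw [← h]
    exact Nat.add_lt_add_left (countEQ_lt k hpq) _

theorem sortPos_inj (k : ℕ → ℕ) {L p q : ℕ} (hp : p < L) (hq : q < L)
    (h : sortPos k L p = sortPos k L q) : p = q := by
  by_contra hne
  have h1 := mt (sortPos_lt_sortPos k (q := q) hp) (by omega)
  have h2 := mt (sortPos_lt_sortPos k (q := p) hq) (by omega)
  omega

/-- `sortPos` is injective from a finite set to itself, hence surjective. The entries with key at
most v fill exactly the positions below `countLT k L (v + 1)`. -/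
theorem isStableSort_sortPos {k a b bn : ℕ → ℕ} {L R : ℕ}
    (hb : ∀ p < L, b (sortPos k L p) = a p)
    (hbin : ∀ v < R, bn v = countLT k L v + countEQ k L v) :
    IsStableSort k a b bn L R (sortPos k L) := by
  have hlt : ∀ p < L, sortPos k L p < L := fun p hp =>
    (sortPos_lt_countLT k hp).trans_le (countLT_le _ _ _)
  refine ⟨hlt, hb, ?_, fun p hp q _ => sortPos_lt_sortPos k hp, ?_, ?_⟩
  · intro q hq
    have := Finset.surj_on_of_inj_on_of_card_le (s := Finset.range L) (t := Finset.range L)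
      (fun p _ => sortPos k L p) (fun p hp => by simpa using hlt p (by simpa using hp))
      (fun p q hp hq h => sortPos_inj k (by simpa using hp) (by simpa using hq) h) le_rfl q
      (by simpa using hq)
    obtain ⟨p, hp, h⟩ := this
    exact ⟨p, by simpa using hp, h.symm⟩
  · intro v hv p hp
    rw [hbin v hv, ← countLT_succ]
    constructor
    · intro h
      by_contra hlt
      have h1 := countLT_mono k L (show v + 1 ≤ k p by omega)
      unfold sortPos at h
      omega
    · intro h
      exact (sortPos_lt_countLT k hp).trans_le (countLT_mono k L (by omega))
  · intro v hv
    rw [hbin v hv, ← countLT_succ]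
    exact countLT_le _ _ _

/-- Invariants of the four loops: `bin` is cleared; `bin v` counts the entries with key v seen so
far; prefix sums turn these counts into `countLT`; finally `bin v` is the next free place for key v,
so entry n lands at `sortPos k L n`. Injectivity of `sortPos` protects what is already written, and
the arrays are assumed different to exclude aliasing. -/
theorem histogramSort_runs {key a b : Arr} {range len : Exp} {σ : Store} (R L : ℕ)
    (hkb : key ≠ b) (hkbin : key ≠ Arr.bin) (hab : a ≠ b) (habin : a ≠ Arr.bin)
    (hbbin : b ≠ Arr.bin)
    (hR : ∀ τ, Agree (histogramSort key range len a b) σ τ → range.eval τ = R)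
    (hL : ∀ τ, Agree (histogramSort key range len a b) σ τ → len.eval τ = L)
    (hk : ∀ p < L, σ.arr key (σ.arr a p) < R) :
    Runs (histogramSort key range len a b) σ ((R + L + 1) * (2 * (range.cost + len.cost) + 80))
      fun τ => Agree (histogramSort key range len a b) σ τ ∧
        ∃ pos, IsStableSort (fun p => σ.arr key (σ.arr a p)) (σ.arr a) (τ.arr b) (τ.arr Arr.bin)
          L R pos := by
  set k : ℕ → ℕ := fun p => σ.arr key (σ.arr a p) with hkdef
  have hA : ∀ τ, Agree (histogramSort key range len a b) σ τ →
      τ.arr key = σ.arr key ∧ τ.arr a = σ.arr a := fun τ h =>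
    ⟨h.arr key (by simp [histogramSort, forLoop, Cmd.writesArr, hkb.symm, hkbin.symm]),
      h.arr a (by simp [histogramSort, forLoop, Cmd.writesArr, hab.symm, habin.symm])⟩
  have main : Runs (histogramSort key range len a b) σ
      ((R + 1) * (4 + range.cost + 7) + ((L + 1) * (12 + len.cost + 7) + (2 +
        ((R + 1) * (12 + range.cost + 7) + (L + 1) * (18 + len.cost + 7))))) fun τ =>
      (∀ v < R, τ.arr Arr.bin v = countLT k L v + countEQ k L v) ∧
        ∀ p < L, τ.arr b (sortPos k L p) = τ.arr a p := by
    refine .seq_agree (Runs.forLoop (K := 4) R (fun n τ => ∀ v < n, τ.arr Arr.bin v = 0) rfl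
      (fun τ h => hR τ (h.seq_left _)) (by simp) ?_) ?_
    · intro n hn τ _ hj hI
      refine .of_wp (by decide) ?_
      simp only [Cmd.wp, Exp.eval, hj, Store.setReg_arr, Store.setArr_arr_self]
      intro v hv
      rw [Function.update_apply]
      split_ifs with h
      · rfl
      · exact hI v (by omega)
    intro τ₁ hA₁ ⟨_, hI₁⟩
    replace hA₁ := hA₁.seq_left
    refine .seq_agree (Runs.forLoop (K := 12) L
      (fun n τ => ∀ v < R, τ.arr Arr.bin v = countEQ k n v) rfl
      (fun τ h => hL τ ((hA₁ _).trans ((h.seq_left _).seq_right _))) ?_ ?_) ?_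
    · intro v hv
      simpa [countEQ] using hI₁ v hv
    · intro n hn τ hAτ hi hI
      have hAτ' := hA τ ((hA₁ _).trans ((hAτ.seq_left _).seq_right _))
      refine .of_wp (Nat.le_of_ble_eq_true rfl) ?_
      have hkn : τ.arr key (τ.arr a n) = k n := by rw [hAτ'.1, hAτ'.2]
      simp only [Cmd.wp, Exp.eval, hi, Store.setReg_arr,
        Store.setArr_arr_self, Store.setReg_reg_self, hkn]
      intro v hv
      rw [Function.update_apply, countEQ_succ]
      split_ifs with h1 h2 h2
      · rw [hI _ (hk n hn), h1]
      · exact absurd h1.symm h2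
      · exact absurd h2.symm h1
      · exact hI v hv
    intro τ₂ hA₂ ⟨_, hI₂⟩
    replace hA₂ := fun x => (hA₁ _).trans ((hA₂.seq_left x).seq_right _)
    refine .seq_agree (Runs.of_wp (K := 2) (Q := fun τ => τ.arr = τ₂.arr ∧ τ.reg total = 0)
      (by decide) (by simp)) ?_
    intro τ₃ hA₃ ⟨hτ₃, ht₃⟩
    replace hA₃ := fun x => (hA₂ _).trans (((hA₃.seq_left x).seq_right _).seq_right _)
    refine .seq_agree (Runs.forLoop (K := 12) R
      (fun n τ => τ.reg total = countLT k L n ∧ ∀ v < R, τ.arr Arr.bin v =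
        if v < n then countLT k L v else countEQ k L v) rfl
      (fun τ h => hR τ ((hA₃ _).trans ((((h.seq_left _).seq_right _).seq_right _).seq_right _)))
        ?_ ?_) ?_
    · refine ⟨?_, fun v hv => ?_⟩
      · rw [Store.setReg_reg_of_ne _ _ (by simp), ht₃, countLT_zero]
      · simpa [hτ₃] using hI₂ v hv
    · intro n hn τ _ hj ⟨ht, hI⟩
      refine .of_wp (by decide) ?_
      simp only [Cmd.wp, Exp.eval]
      refine ⟨?_, fun v hv => ?_⟩
      · simp [ht, hj, hI n hn, countLT_succ]
      · simp only [Store.setReg_arr, Store.setArr_arr_self, Function.update_apply]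
        simp only [ne_eq, reduceCtorEq, not_false_eq_true, Store.setReg_reg_of_ne, hj, ht]
        by_cases h : v = n
        · simp [h]
        · rw [if_neg h, hI v hv]
          split_ifs <;> first | rfl | omega
    intro τ₄ hA₄ ⟨_, _, hI₄⟩
    replace hA₄ := fun x => (hA₃ _).trans
      ((((hA₄.seq_left x).seq_right _).seq_right _).seq_right _)
    refine (Runs.forLoop (K := 18) L (fun n τ => (∀ v < R, τ.arr Arr.bin v =
        countLT k L v + countEQ k n v) ∧ ∀ p < n, τ.arr b (sortPos k L p) = σ.arr a p) rfl
      (fun τ h => hL τ ((hA₄ _).trans ((((h.seq_right _).seq_right _).seq_right _).seq_right _)))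
        ?_ ?_).mono le_rfl ?_
    · refine ⟨fun v hv => ?_, by simp⟩
      have := hI₄ v hv
      rw [if_pos hv] at this
      simpa [countEQ] using this
    · intro n hn τ hAτ hi ⟨hI, hJ⟩
      have hAτ' := hA τ ((hA₄ _).trans
        ((((hAτ.seq_right _).seq_right _).seq_right _).seq_right _))
      refine .of_wp (Nat.le_of_ble_eq_true rfl) ?_
      have hkn : τ.arr key (τ.arr a n) = k n := by rw [hAτ'.1, hAτ'.2]
      simp only [Cmd.wp, Exp.eval, hi, Store.setReg_arr,
        Store.setArr_arr_self, Store.setArr_reg, Store.setReg_reg_self, hkn, ne_eq, reduceCtorEq,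
        not_false_eq_true, Store.setReg_reg_of_ne, hbbin, hbbin.symm, Store.setArr_arr_of_ne]
      refine ⟨fun v hv => ?_, fun p hp => ?_⟩
      · rw [Function.update_apply, countEQ_succ]
        split_ifs with h1 h2 h2
        · rw [hI _ (hk n hn), h1, add_assoc]
        · exact absurd h1.symm h2
        · exact absurd h2.symm h1
        · exact hI v hv
      · rw [hI _ (hk n hn), Function.update_apply, hAτ'.2]
        by_cases hpn : p = n
        · rw [hpn]; exact if_pos rfl
        · rw [if_neg, hJ p (by omega)]
          intro h
          exact hpn (sortPos_inj k (L := L) (by omega) hn h)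
    · rintro τ ⟨hAτ, hI, hJ⟩
      have hAτ' := hA τ ((hA₄ _).trans
        ((((hAτ.seq_right _).seq_right _).seq_right _).seq_right _))
      exact ⟨hI, fun p hp => by rw [hJ p hp, hAτ'.2]⟩
  refine main.agree.mono ?_ ?_
  · simp only [Nat.add_mul, Nat.mul_add]
    nlinarith
  · rintro τ ⟨hAτ, hbin, hb⟩
    exact ⟨hAτ, _, isStableSort_sortPos (fun p hp => by rw [hb p hp, (hA τ hAτ).2]) hbin⟩

end SuperHierarchy

namespace SuperHierarchy

open Reg Arr WArr Exp Test Cmd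

/-! ## The current graph -/

/-- The graph on the natural numbers with the edges `{s k, d k}`, `k < m`. -/
def arrGraph (s d : ℕ → ℕ) (m : ℕ) : SimpleGraph ℕ where
  Adj a b := a ≠ b ∧ ∃ k < m, (s k = a ∧ d k = b) ∨ (s k = b ∧ d k = a)
  symm := ⟨fun _ _ ⟨h, k, hk, h'⟩ => ⟨h.symm, k, hk, h'.symm⟩⟩
  loopless := ⟨fun _ h => h.1 rfl⟩

/-- The arrays `s` and `d` list the edges of a connected simple graph with vertices `0, …, n - 1`
which is a minor of a planar graph. -/
structure IsGraph (n m : ℕ) (s d : ℕ → ℕ) : Prop where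
  src_lt : ∀ k < m, s k < n
  dst_lt : ∀ k < m, d k < n
  ne : ∀ k < m, s k ≠ d k
  inj : ∀ k < m, ∀ k' < m, s(s k, d k) = s(s k', d k') → k = k'
  connected : ∀ a < n, ∀ b < n, (arrGraph s d m).Reachable a b
  drawable : WeaklyDrawable (arrGraph s d m)

/-- The memory `σ` holds the graph with `n` vertices and `m` edges. -/
structure Holds (n m : ℕ) (σ : Store) : Prop where
  numV : σ.reg numV = n
  numE : σ.reg numE = m
  graph : IsGraph n m (σ.arr src) (σ.arr dst)

namespace IsGraph

variable {n m : ℕ} {s d : ℕ → ℕ}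

/-- Each edge yields the arc from `s k` to `d k`, and different edges yield different arcs. -/
theorem card_edges_le (h : IsGraph n m s d) : m ≤ 32 * n := by
  classical
  have h1 := h.drawable.arcsIn_le (Finset.range n)
  rw [Finset.card_range] at h1
  refine le_trans ?_ h1
  unfold arcsIn degIn
  rw [← Finset.card_sigma]
  conv_lhs => rw [← Finset.card_range m]
  refine Finset.card_le_card_of_injOn (fun k => ⟨s k, d k⟩) ?_ ?_
  · intro k hk
    simp only [Finset.coe_range, Set.mem_Iio] at hk
    simp only [Finset.coe_sigma, Set.mem_sigma_iff, Finset.coe_range, Set.mem_Iio,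
      Finset.coe_filter, Finset.mem_range, Set.mem_ofPred_eq]
    exact ⟨h.src_lt k hk, h.dst_lt k hk, h.ne k hk, k, hk, Or.inl ⟨rfl, rfl⟩⟩
  · intro k hk k' hk' hkk
    simp only [Finset.coe_range, Set.mem_Iio] at hk hk'
    simp only [Sigma.mk.injEq, heq_eq_eq] at hkk
    exact h.inj k hk k' hk' (by rw [hkk.1, hkk.2])

/-- The first edge of a walk to a second vertex. This guarantees that no vertex keeps the
placeholder `numE` after the search. -/
theorem exists_incident (h : IsGraph n m s d) (hn : 1 < n) {v : ℕ} (hv : v < n) :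
    ∃ k < m, s k = v ∨ d k = v := by
  obtain ⟨w, hw, hvw⟩ : ∃ w < n, v ≠ w := by
    rcases Nat.eq_zero_or_pos v with rfl | hv0
    · exact ⟨1, hn, by omega⟩
    · exact ⟨0, by omega, by omega⟩
  obtain ⟨p⟩ := h.connected v hv w hw
  cases p with
  | nil => exact absurd rfl hvw
  | cons hadj _ =>
    obtain ⟨-, k, hk, hk'⟩ := hadj
    exact ⟨k, hk, hk'.imp (·.1) (·.2)⟩

end IsGraph

/-! ## Nearest neighbour search -/

/-- For the time bound it only matters that `best v` is some edge at v, so the invariant ignores the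
outcome of weight comparisons. -/
theorem nearestNeighbours_runs {n m : ℕ} {σ : Store} (h : Holds n m σ) (hn : 1 < n) :
    Runs nearestNeighbours σ (100 * (n + m + 1)) fun τ => ∀ v < n,
      τ.arr best v < m ∧ (σ.arr src (τ.arr best v) = v ∨ σ.arr dst (τ.arr best v) = v) := by
  have main : Runs nearestNeighbours σ ((n + 1) * (3 + 1 + 7) + (m + 1) * (60 + 1 + 7)) fun τ =>
      ∀ v < n, (τ.arr best v = m ∧ ∀ k < m, σ.arr src k ≠ v ∧ σ.arr dst k ≠ v) ∨
      (τ.arr best v < m ∧ (σ.arr src (τ.arr best v) = v ∨ σ.arr dst (τ.arr best v) = v)) := by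
    refine .seq_agree (Runs.forLoop (K := 3) n (fun k τ => ∀ v < k, τ.arr best v = m) rfl
      (fun τ hτ => (hτ.reg numV rfl).trans h.numV) (by simp) ?_) ?_
    · intro k hk τ hA hi hI
      refine .of_wp (by decide) ?_
      have : τ.reg numE = m := (hA.reg numE rfl).trans h.numE
      simp only [Cmd.wp, Exp.eval, Store.setReg_arr, Store.setArr_arr_self, hi, this]
      intro v hv
      rw [Function.update_apply]
      split_ifs with h
      · rfl
      · exact hI v (by omega)
    intro τ₁ hA₁ ⟨_, hI₁⟩
    refine Runs.mono (Runs.forLoop (K := 60) m (fun k τ => ∀ v < n,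
      (τ.arr best v = m ∧ ∀ k' < k, σ.arr src k' ≠ v ∧ σ.arr dst k' ≠ v) ∨
      (τ.arr best v < m ∧ (σ.arr src (τ.arr best v) = v ∨ σ.arr dst (τ.arr best v) = v))) rfl
      (fun τ hτ => (hτ.reg numE rfl).trans ((hA₁.reg numE rfl).trans h.numE)) ?_ ?_) le_rfl
      fun τ hτ => hτ.2
    · intro v hv
      exact Or.inl ⟨hI₁ v hv, by simp⟩
    · intro k hk τ hA hi hI
      have hE : τ.reg numE = m := (hA.reg numE rfl).trans ((hA₁.reg numE rfl).trans h.numE)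
      have hs : τ.arr src = σ.arr src := (hA.arr src rfl).trans (hA₁.arr src rfl)
      have hd : τ.arr dst = σ.arr dst := (hA.arr dst rfl).trans (hA₁.arr dst rfl)
      refine .of_wp (by decide) ?_
      simp only [Cmd.wp, Exp.eval, Test.Holds, Store.setReg_arr, Store.setArr_arr_self,
        Store.setArr_reg, Store.setReg_reg_self, ne_eq, reduceCtorEq, not_false_eq_true,
        Store.setReg_reg_of_ne, Store.setArr_arr_of_ne, hi, hE, hs, hd]
      refine ⟨fun _ => ⟨fun _ => ?_, fun h2 => ?_⟩, fun h1 => ⟨fun _ => ?_, fun h2 => ?_⟩⟩ <;>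
        intro v hv <;> have hv' := hI v hv <;> clear hI hs hd hE hA hI₁ hA₁ h
      all_goals
        try rw [not_or] at h1
        try rw [not_or] at h2
        try have h1 := h1.1
        try have h2 := h2.1
        try simp only [Function.update_apply] at *
        grind
  refine main.mono (by omega) ?_
  intro τ hτ v hv
  rcases hτ v hv with ⟨-, hv'⟩ | hv'
  · obtain ⟨k, hk, hk'⟩ := h.graph.exists_incident hn hv
    have := hv' k hk
    tauto
  · exact hv'

/-! ## The auxiliary graph -/

/-- The first position behind the arcs with tails below `v`. -/
def arcStart (bn : ℕ → ℕ) (v : ℕ) : ℕ := if v = 0 then 0 else bn (v - 1)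

/-- The arcs with tail `v` of the auxiliary graph `R` on the vertices `0, …, n - 1` are stored at
the positions from `arcStart bn v` on and below `bn v`, and `hd` gives their heads. -/
structure IsArcList (n : ℕ) (R : ℕ → ℕ → Prop) (bn hd : ℕ → ℕ) : Prop where
  symm : ∀ v w, R v w → R w v
  start_le : ∀ v < n, arcStart bn v ≤ bn v
  le : ∀ v < n, bn v ≤ 2 * n
  sound : ∀ v < n, ∀ q, arcStart bn v ≤ q → q < bn v → hd q < n ∧ R v (hd q)
  complete : ∀ v < n, ∀ w < n, R v w → ∃ q, arcStart bn v ≤ q ∧ q < bn v ∧ hd q = w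

/-- The partner of v is the sum of the ends of `best v` minus v; the truncated subtraction is exact
because v is one of the ends. The existential `R` is the symmetric closure of "chosen by". It lies
inside the current graph and leaves no vertex isolated. -/
theorem chooseEdges_runs {n m : ℕ} {σ : Store} (h : Holds n m σ)
    (hb : ∀ v < n, σ.arr best v < m ∧
      (σ.arr src (σ.arr best v) = v ∨ σ.arr dst (σ.arr best v) = v)) :
    Runs chooseEdges σ (400 * (n + 1)) fun τ => ∃ R : ℕ → ℕ → Prop,
      (∀ v w, R v w → (arrGraph (σ.arr src) (σ.arr dst) m).Adj v w) ∧
      (∀ v < n, ∃ w < n, R v w) ∧ IsArcList n R (τ.arr bin) (fun q => τ.arr head (τ.arr adj q)) := by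
  set s := σ.arr src
  set d := σ.arr dst
  set y : ℕ → ℕ := fun v => s (σ.arr best v) + d (σ.arr best v) - v with hy
  have hadj : ∀ v < n, (arrGraph s d m).Adj v (y v) ∧ y v < n := by
    intro v hv
    obtain ⟨h1, h2⟩ := hb v hv
    have h3 := h.graph.ne _ h1
    have h4 := h.graph.src_lt _ h1
    have h5 := h.graph.dst_lt _ h1
    change s _ ≠ d _ at h3
    change s _ < n at h4
    change d _ < n at h5
    have : y v = s (σ.arr best v) + d (σ.arr best v) - v := rfl
    rcases h2 with h2 | h2
    · exact ⟨⟨by omega, _, h1, Or.inl ⟨h2, by omega⟩⟩, by omega⟩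
    · exact ⟨⟨by omega, _, h1, Or.inr ⟨by omega, h2⟩⟩, by omega⟩
  -- The choice of v is entered at position v as an arc out of v and at position n + v as the
  -- opposite arc.
  let I : ℕ → Store → Prop := fun k τ => ∀ v < k, τ.arr tail v = v ∧ τ.arr head v = y v ∧
    τ.arr tail (n + v) = y v ∧ τ.arr head (n + v) = v ∧ τ.arr arcs v = v ∧
    τ.arr arcs (n + v) = n + v
  have main : Runs chooseEdges σ ((n + 1) * (100 + 1 + 7) +
      (n + 2 * n + 1) * (2 * (1 + 3) + 80)) fun τ =>
      (∀ p < 2 * n, τ.arr arcs p = p) ∧ I n τ ∧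
      ∃ pos, IsStableSort (τ.arr tail) id (τ.arr adj) (τ.arr bin) (2 * n) n pos := by
    refine .seq_agree (Runs.forLoop (K := 100) n I rfl
      (fun τ hτ => (hτ.reg numV rfl).trans h.numV) (by simp [I]) ?_) ?_
    · intro k hk τ hA hi hI
      have hV : τ.reg numV = n := (hA.reg numV rfl).trans h.numV
      have hs : τ.arr src = s := hA.arr src rfl
      have hd : τ.arr dst = d := hA.arr dst rfl
      have hbe : τ.arr best = σ.arr best := hA.arr best rfl
      refine .of_wp (by decide) ?_
      simp only [Cmd.wp, Exp.eval, Exp.eval_sub, Store.setReg_arr,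
        Store.setArr_reg, Store.setReg_reg_self, ne_eq, reduceCtorEq,
        not_false_eq_true, Store.setReg_reg_of_ne, hi, hV, hs, hd, hbe]
      refine ⟨fun _ v hv => ?_, fun _ v hv => ?_⟩
      all_goals
        have hv' := fun h : v < k => hI v h
        clear hI hA hs hd hbe hV hadj hb h
        simp only [Function.update_apply, Store.setArr_arr_self, Store.setReg_arr, ne_eq,
          reduceCtorEq, not_false_eq_true, Store.setArr_arr_of_ne]
        rcases Nat.lt_succ_iff_lt_or_eq.1 hv with hlt | rfl
        · obtain ⟨e1, e2, e3, e4, e5, e6⟩ := hv' hlt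
          have c1 : v ≠ n + k := by omega
          have c2 : n + v ≠ k := by omega
          have c3 : v ≠ k := by omega
          have c4 : n + v ≠ n + k := by omega
          simp [*]
        · have c1 : n ≠ 0 := by omega
          simp [c1, hy]
    · intro τ₁ hA₁ ⟨_, hI₁⟩
      have hV : τ₁.reg numV = n := (hA₁.reg numV rfl).trans h.numV
      have harcs : ∀ p < 2 * n, τ₁.arr arcs p = p := by
        intro p hp
        by_cases hpn : p < n
        · exact (hI₁ p hpn).2.2.2.2.1
        · have := (hI₁ (p - n) (by omega)).2.2.2.2.2
          rwa [show n + (p - n) = p by omega] at this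
      have htail : ∀ p < 2 * n, τ₁.arr tail p < n := by
        intro p hp
        by_cases hpn : p < n
        · rw [(hI₁ p hpn).1]; exact hpn
        · have := (hI₁ (p - n) (by omega)).2.2.1
          rw [show n + (p - n) = p by omega] at this
          rw [this]
          exact (hadj _ (by omega)).2
      refine Runs.mono (histogramSort_runs (R := n) (L := 2 * n) (by decide) (by decide) (by decide)
        (by decide) (by decide) (fun τ hτ => (hτ.reg numV rfl).trans hV) ?_ ?_) le_rfl ?_
      · intro τ hτ
        have : τ.reg numV = n := (hτ.reg numV rfl).trans hV
        simp only [Exp.eval, this]; omega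
      · intro p hp
        rw [harcs p hp]; exact htail p hp
      · rintro τ ⟨hA, pos, hpos⟩
        have e1 : τ.arr arcs = τ₁.arr arcs := hA.arr arcs rfl
        have e2 : τ.arr tail = τ₁.arr tail := hA.arr tail rfl
        have e3 : τ.arr head = τ₁.arr head := hA.arr head rfl
        refine ⟨by rw [e1]; exact harcs, by simp only [I, e1, e2, e3]; exact hI₁, pos, ?_⟩
        have hk : ∀ p < 2 * n, τ₁.arr tail (τ₁.arr arcs p) = τ.arr tail p := fun p hp => by
          rw [harcs p hp, e2]
        refine ⟨hpos.lt, fun p hp => ?_, hpos.surj, fun p hp q hq hpq => ?_,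
          fun v hv p hp => ?_, hpos.bin_le⟩
        · rw [hpos.eq p hp, harcs p hp]; rfl
        · apply hpos.mono p hp q hq
          simp only [hk p hp, hk q hq]; exact hpq
        · rw [hpos.lt_bin v hv p hp, hk p hp]
  refine main.mono (by omega) ?_
  rintro τ ⟨-, hI, pos, hpos⟩
  -- After sorting, the arcs with tail v form the block from `bin[v - 1]` up to but excluding
  -- `bin[v]`.
  have htl : ∀ v < n, ∀ p < 2 * n,
      (arcStart (τ.arr bin) v ≤ pos p ∧ pos p < τ.arr bin v ↔ τ.arr tail p = v) := by
    intro v hv p hp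
    rw [hpos.lt_bin v hv p hp]
    unfold arcStart
    split_ifs with h0
    · omega
    · have := hpos.lt_bin (v - 1) (by omega) p hp
      omega
  refine ⟨fun v w => v < n ∧ w < n ∧ (y v = w ∨ y w = v), ?_, ?_, ?_, ?_, ?_, ?_, ?_⟩
  · rintro v w ⟨hv, hw, rfl | rfl⟩
    · exact (hadj v hv).1
    · exact (hadj w hw).1.symm
  · exact fun v hv => ⟨y v, (hadj v hv).2, hv, (hadj v hv).2, Or.inl rfl⟩
  · exact fun v w ⟨hv, hw, h⟩ => ⟨hw, hv, h.symm⟩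
  · intro v hv
    unfold arcStart
    split_ifs with h0
    · exact Nat.zero_le _
    · by_contra hlt
      obtain ⟨p, hp, hp'⟩ := hpos.surj (τ.arr bin v)
        (lt_of_lt_of_le (not_le.1 hlt) (hpos.bin_le (v - 1) (by omega)))
      have h1 := hpos.lt_bin v hv p hp
      have h2 := hpos.lt_bin (v - 1) (by omega) p hp
      omega
  · exact fun v hv => hpos.bin_le v hv
  · intro v hv q hq1 hq2
    obtain ⟨p, hp, rfl⟩ := hpos.surj q (hq2.trans_le (hpos.bin_le v hv))
    have ht := (htl v hv p hp).1 ⟨hq1, hq2⟩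
    rw [hpos.eq p hp, id]
    by_cases hpn : p < n
    · obtain ⟨e1, e2, -⟩ := hI p hpn
      have : p = v := e1.symm.trans ht
      subst this
      rw [e2]
      exact ⟨(hadj _ hv).2, hv, (hadj _ hv).2, Or.inl rfl⟩
    · obtain ⟨-, -, e3, e4, -⟩ := hI (p - n) (by omega)
      rw [show n + (p - n) = p by omega] at e3 e4
      rw [e4]
      exact ⟨by omega, hv, by omega, Or.inr (e3.symm.trans ht)⟩
  · rintro v hv w hw ⟨-, -, h | h⟩
    · refine ⟨pos v, ?_⟩
      rw [hpos.eq v (by omega), id, ← and_assoc]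
      exact ⟨(htl v hv v (by omega)).2 (hI v hv).1, (hI v hv).2.1.trans h⟩
    · refine ⟨pos (n + w), ?_⟩
      rw [hpos.eq (n + w) (by omega), id, ← and_assoc]
      exact ⟨(htl v hv (n + w) (by omega)).2 ((hI w hw).2.2.1.trans h), (hI w hw).2.2.2.1⟩

end SuperHierarchy

namespace SuperHierarchy

open Reg Arr WArr Exp Test Cmd

/-! ## Depth-first search -/

/-- The state of the depth-first search when `c` components have been started. -/
structure IsDFS (n c : ℕ) (G : SimpleGraph ℕ) (bn hd lab nxt stk : ℕ → ℕ) (tp : ℕ) : Prop where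
  stack_mem : ∀ p < tp, stk p < n ∧ lab (stk p) + 1 = c
  start_le : ∀ v < n, arcStart bn v ≤ nxt v
  le_end : ∀ v < n, nxt v ≤ bn v
  label_lt : ∀ v < n, lab v = n ∨ lab v < c
  explored : ∀ v < n, ∀ q, arcStart bn v ≤ q → q < nxt v → lab v ≠ n ∧ lab (hd q) = lab v
  finished : ∀ v < n, lab v ≠ n → nxt v = bn v ∨ (lab v + 1 = c ∧ ∃ p < tp, stk p = v)
  connected : ∀ b, b ≠ n → ConnectedIn G {v | v < n ∧ lab v = b}
  attained : ∀ b < c, ∃ v < n, lab v = b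

namespace IsDFS

variable {n c : ℕ} {G : SimpleGraph ℕ} {R : ℕ → ℕ → Prop} {bn hd lab nxt stk : ℕ → ℕ} {tp : ℕ}

theorem label_lt_of_mem (h : IsDFS n c G bn hd lab nxt stk tp) (hc : c ≤ n) {p : ℕ} (hp : p < tp) :
    lab (stk p) < n := by
  have := (h.stack_mem p hp).2; omega

/-- The stack is empty, so all earlier labelled vertices are finished. The label `c` is new and, by
`c < n`, different from the mark n for unvisited vertices. -/
theorem push_root (h : IsDFS n c G bn hd lab nxt stk 0) (hc : c < n) {r : ℕ} (hr : r < n)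
    (hlr : lab r = n) :
    IsDFS n (c + 1) G bn hd (Function.update lab r c) nxt (Function.update stk 0 r) 1 := by
  refine ⟨?_, h.start_le, h.le_end, ?_, ?_, ?_, ?_, ?_⟩
  · intro p hp
    obtain rfl : p = 0 := by omega
    simp [hr]
  · intro v hv
    rw [Function.update_apply]
    have := h.label_lt v hv
    split_ifs <;> omega
  · intro v hv q hq hq'
    obtain ⟨h1, h2⟩ := h.explored v hv q hq hq'
    have h3 : v ≠ r := by rintro rfl; exact h1 hlr
    have h4 : hd q ≠ r := by intro h4; rw [h4] at h2; exact h1 (h2 ▸ hlr)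
    simp [h3, h4, h1, h2]
  · intro v hv hl
    rcases eq_or_ne v r with rfl | hvr
    · exact Or.inr ⟨by simp, 0, by simp⟩
    · rw [Function.update_of_ne hvr] at hl
      rcases h.finished v hv hl with h1 | ⟨-, p, hp, -⟩
      · exact Or.inl h1
      · omega
  · intro b hb
    rcases eq_or_ne b c with rfl | hbc
    · have : {v | v < n ∧ Function.update lab r b v = b} = {r} := by
        ext v
        simp only [Set.mem_ofPred_eq, Set.mem_singleton_iff, Function.update_apply]
        constructor
        · rintro ⟨hv, hv'⟩
          by_contra hvr
          rw [if_neg hvr] at hv'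
          have := h.label_lt v hv
          omega
        · rintro rfl; simp [hr]
      rw [this]
      intro x hx y hy
      rw [Set.mem_singleton_iff.1 hx, Set.mem_singleton_iff.1 hy]
    · have : {v | v < n ∧ Function.update lab r c v = b} = {v | v < n ∧ lab v = b} := by
        ext v
        simp only [Set.mem_ofPred_eq, Function.update_apply]
        by_cases hvr : v = r
        · subst hvr; simp [hlr, hbc.symm, hb.symm]
        · simp [hvr]
      rw [this]; exact h.connected b hb
  · intro b hb
    rcases Nat.lt_succ_iff_lt_or_eq.1 hb with hb | rfl
    · obtain ⟨v, hv, rfl⟩ := h.attained b hb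
      refine ⟨v, hv, ?_⟩
      rw [Function.update_of_ne]
      rintro rfl; omega
    · exact ⟨r, hr, by simp⟩

/-- The removed vertex has no arcs left, so it satisfies the first alternative of `finished`. -/
theorem pop (h : IsDFS n c G bn hd lab nxt stk (tp + 1)) (hx : ¬ nxt (stk tp) < bn (stk tp)) :
    IsDFS n c G bn hd lab nxt stk tp := by
  refine ⟨fun p hp => h.stack_mem p (by omega), h.start_le, h.le_end, h.label_lt, h.explored,
    fun v hv hl => ?_, h.connected, h.attained⟩
  rcases h.finished v hv hl with h1 | ⟨h1, p, hp, rfl⟩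
  · exact Or.inl h1
  · rcases Nat.lt_succ_iff_lt_or_eq.1 hp with hp | rfl
    · exact Or.inr ⟨h1, p, hp, rfl⟩
    · exact Or.inl (le_antisymm (h.le_end _ hv) (not_lt.1 hx))

/-- The labelled head y of an arc from x must carry the label of x. Otherwise y belongs to an
earlier component and all its arcs are explored, among them the reverse arc to x, which forces equal
labels. -/
theorem skip_visited (h : IsDFS n c G bn hd lab nxt stk (tp + 1)) (hR : IsArcList n R bn hd)
    (hc : c ≤ n) (hx : nxt (stk tp) < bn (stk tp)) (hy : lab (hd (nxt (stk tp))) ≠ n) :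
    IsDFS n c G bn hd lab (Function.update nxt (stk tp) (nxt (stk tp) + 1)) stk (tp + 1) := by
  obtain ⟨hxn, hxl⟩ := h.stack_mem tp (by omega)
  have hxl' := h.label_lt_of_mem hc (Nat.lt_succ_self tp)
  generalize hxx : stk tp = x at *
  obtain ⟨hyn, hxy⟩ := hR.sound x hxn _ (h.start_le x hxn) hx
  have hlab : lab (hd (nxt x)) = lab x := by
    by_contra hne
    rcases h.finished _ hyn hy with h1 | ⟨h1, -⟩
    · obtain ⟨q, hq1, hq2, hq3⟩ := hR.complete _ hyn x hxn (hR.symm _ _ hxy)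
      have := (h.explored _ hyn q hq1 (h1 ▸ hq2)).2
      rw [hq3] at this
      exact hne this.symm
    · omega
  refine ⟨h.stack_mem, ?_, ?_, h.label_lt, ?_, ?_, h.connected, h.attained⟩
  · intro v hv
    have := h.start_le v hv
    rw [Function.update_apply]
    split_ifs with hvx
    · subst hvx; omega
    · exact this
  · intro v hv
    have := h.le_end v hv
    rw [Function.update_apply]
    split_ifs with hvx
    · subst hvx; omega
    · exact this
  · intro v hv q hq hq'
    rw [Function.update_apply] at hq'
    split_ifs at hq' with hvx
    · subst hvx
      rcases Nat.lt_succ_iff_lt_or_eq.1 hq' with hq' | rfl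
      · exact h.explored v hv q hq hq'
      · exact ⟨by omega, hlab⟩
    · exact h.explored v hv q hq hq'
  · intro v hv hl
    rcases eq_or_ne v x with rfl | hvx
    · exact Or.inr ⟨hxl, tp, by omega, hxx⟩
    · rw [Function.update_of_ne hvx]
      exact h.finished v hv hl

/-- An unlabelled vertex has no explored arcs, so its pointer is still at the start of its block.
Its class grows by a neighbour and stays connected. -/
theorem visit (h : IsDFS n (c + 1) G bn hd lab nxt stk (tp + 1)) (hR : IsArcList n R bn hd)
    (hRG : ∀ v w, R v w → G.Adj v w)
    (hc : c < n) (hx : nxt (stk tp) < bn (stk tp)) (hy : lab (hd (nxt (stk tp))) = n) :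
    IsDFS n (c + 1) G bn hd (Function.update lab (hd (nxt (stk tp))) c)
      (Function.update nxt (stk tp) (nxt (stk tp) + 1))
      (Function.update stk (tp + 1) (hd (nxt (stk tp)))) (tp + 2) := by
  obtain ⟨hxn, hxl⟩ := h.stack_mem tp (by omega)
  generalize hxx : stk tp = x at *
  obtain ⟨hyn, hxy⟩ := hR.sound x hxn _ (h.start_le x hxn) hx
  generalize hyy : hd (nxt x) = y at *
  have hne : x ≠ y := by rintro rfl; omega
  have hnxy : nxt y = arcStart bn y := by
    by_contra hlt
    have h1 := h.start_le y hyn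
    exact (h.explored y hyn _ le_rfl (by omega)).1 hy
  have hlab : ∀ v < n, lab v ≠ n → v ≠ y := by rintro v - hv rfl; exact hv hy
  refine ⟨?_, ?_, ?_, ?_, ?_, ?_, ?_, ?_⟩
  · intro p hp
    rcases Nat.lt_succ_iff_lt_or_eq.1 hp with hp | rfl
    · obtain ⟨h1, h2⟩ := h.stack_mem p hp
      rw [Function.update_of_ne hp.ne, Function.update_of_ne (hlab _ h1 (by omega))]
      exact ⟨h1, h2⟩
    · simp [hyn]
  · intro v hv
    have := h.start_le v hv
    rw [Function.update_apply]
    split_ifs with hvx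
    · subst hvx; omega
    · exact this
  · intro v hv
    have := h.le_end v hv
    rw [Function.update_apply]
    split_ifs with hvx
    · subst hvx; omega
    · exact this
  · intro v hv
    have := h.label_lt v hv
    rw [Function.update_apply]
    split_ifs <;> omega
  · have hold : ∀ v < n, ∀ q, arcStart bn v ≤ q → q < nxt v →
        Function.update lab y c v ≠ n ∧
          Function.update lab y c (hd q) = Function.update lab y c v := by
      intro v hv q hq hq'
      obtain ⟨h1, h2⟩ := h.explored v hv q hq hq'
      have h3 : hd q ≠ y := by intro h3; rw [h3] at h2; exact h1 (h2 ▸ hy)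
      rw [Function.update_of_ne (hlab v hv h1), Function.update_of_ne h3]
      exact ⟨h1, h2⟩
    intro v hv q hq hq'
    rw [Function.update_apply nxt] at hq'
    split_ifs at hq' with hvx
    · subst hvx
      rcases Nat.lt_succ_iff_lt_or_eq.1 hq' with hq' | rfl
      · exact hold v hv q hq hq'
      · rw [Function.update_of_ne hne, hyy, Function.update_self]
        omega
    · exact hold v hv q hq hq'
  · intro v hv hl
    rcases eq_or_ne v y with rfl | hvy
    · exact Or.inr ⟨by simp, tp + 1, by simp⟩
    rw [Function.update_of_ne hvy] at hl ⊢
    rcases eq_or_ne v x with rfl | hvx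
    · exact Or.inr ⟨hxl, tp, by omega, by rw [Function.update_of_ne (by omega), hxx]⟩
    · rw [Function.update_of_ne hvx]
      refine (h.finished v hv hl).imp id fun ⟨h1, p, hp, h2⟩ => ⟨h1, p, by omega, ?_⟩
      rw [Function.update_of_ne hp.ne, h2]
  · intro b hb
    rcases eq_or_ne b c with rfl | hbc
    · have : {v | v < n ∧ Function.update lab y b v = b} = insert y {v | v < n ∧ lab v = b} := by
        ext v
        simp only [Set.mem_ofPred_eq, Set.mem_insert_iff, Function.update_apply]
        by_cases hvy : v = y
        · simp [hvy, hyn]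
        · simp [hvy]
      rw [this]
      exact (h.connected b hb).insert (u := x) ⟨hxn, by omega⟩ (hRG _ _ hxy)
    · have : {v | v < n ∧ Function.update lab y c v = b} = {v | v < n ∧ lab v = b} := by
        ext v
        simp only [Set.mem_ofPred_eq, Function.update_apply]
        by_cases hvy : v = y
        · subst hvy; simp [hy, hbc.symm, hb.symm]
        · simp [hvy]
      rw [this]; exact h.connected b hb
  · intro b hb
    obtain ⟨v, hv, rfl⟩ := h.attained b hb
    exact ⟨v, hv, Function.update_of_ne (hlab v hv (by omega)) _ _⟩

end IsDFS

/-- The labels `lab v < c` of the vertices `v < n` describe connected parts of `G`, and each part is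
a union of components of `R`. -/
structure IsLabelling (n c : ℕ) (G : SimpleGraph ℕ) (R : ℕ → ℕ → Prop) (lab : ℕ → ℕ) : Prop where
  lt : ∀ v < n, lab v < c
  attained : ∀ b < c, ∃ v < n, lab v = b
  connected : ∀ b < c, ConnectedIn G {v | v < n ∧ lab v = b}
  eq : ∀ v < n, ∀ w < n, R v w → lab v = lab w

/-- The number of arcs which have not been explored. -/
def arcsLeft (n : ℕ) (bn nxt : ℕ → ℕ) : ℕ := ∑ v ∈ Finset.range n, (bn v - nxt v)

theorem arcsLeft_update {n : ℕ} {bn nxt : ℕ → ℕ} {x : ℕ} (hx : x < n) (h : nxt x < bn x) :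
    arcsLeft n bn (Function.update nxt x (nxt x + 1)) + 1 = arcsLeft n bn nxt := by
  unfold arcsLeft
  rw [← Finset.add_sum_erase _ _ (Finset.mem_range.2 hx),
    ← Finset.add_sum_erase _ _ (Finset.mem_range.2 hx), Function.update_self,
    Finset.sum_congr (g := fun v => bn v - nxt v) rfl]
  · omega
  · intro v hv
    rw [Function.update_of_ne (Finset.ne_of_mem_erase hv)]

/-- The sum telescopes, since each block starts where the previous one ends. -/
theorem arcsLeft_arcStart {n : ℕ} {R : ℕ → ℕ → Prop} {bn hd : ℕ → ℕ} (h : IsArcList n R bn hd) :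
    arcsLeft n bn (arcStart bn) ≤ 2 * n := by
  suffices H : ∀ k ≤ n, arcsLeft k bn (arcStart bn) = arcStart bn k by
    rw [H n le_rfl]
    unfold arcStart
    split_ifs with h0
    · omega
    · exact h.le _ (by omega)
  intro k
  induction k with
  | zero => simp [arcsLeft, arcStart]
  | succ k ih =>
    intro hk
    have h1 := ih (by omega)
    have h2 := h.start_le k (by omega)
    unfold arcsLeft at h1 ⊢
    rw [Finset.sum_range_succ, h1]
    simp only [arcStart, Nat.add_sub_cancel] at h2 ⊢
    simp only [Nat.succ_ne_zero, if_false]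
    omega

/-- The body of the loop of the depth-first search from a root. -/
def exploreStep : Cmd :=
  set x (get stack (top - 1)) ;;
  ite (lt (get next x) (get bin x)) (
    set y (get head (get adj (get next x))) ;;
    put next x (get next x + 1) ;;
    ite (eq (get label y) numV) (
      put label y numComp ;;
      put stack top y ;;
      set top (top + 1))
      skip)
    (set top (top - 1))

/-- The invariant of the depth-first search in the component `c`. -/
structure ExploreInv (n c : ℕ) (G : SimpleGraph ℕ) (bn hd adj : ℕ → ℕ) (τ : Store) : Prop where
  numV : τ.reg numV = n
  numComp : τ.reg numComp = c
  bin_eq : τ.arr bin = bn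
  head_eq : τ.arr head = hd
  adj_eq : τ.arr Arr.adj = adj
  dfs : IsDFS n (c + 1) G bn (fun q => hd (adj q)) (τ.arr label) (τ.arr next) (τ.arr stack)
    (τ.reg top)

/-- The measure is twice the number of unexplored arcs plus the stack height. Exploring an arc
lowers it by 2 and pushes at most one vertex; a pop lowers it by 1. -/
theorem exploreStep_runs {n c : ℕ} {G : SimpleGraph ℕ} {R : ℕ → ℕ → Prop} {bn hd adj : ℕ → ℕ}
    (hR : IsArcList n R bn (fun q => hd (adj q))) (hRG : ∀ v w, R v w → G.Adj v w) (hc : c < n)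
    {σ : Store} (hσ : ExploreInv n c G bn hd adj σ) (ht : 0 < σ.reg top) :
    Runs exploreStep σ 50 fun τ => ExploreInv n c G bn hd adj τ ∧
      2 * arcsLeft n bn (τ.arr next) + τ.reg top <
        2 * arcsLeft n bn (σ.arr next) + σ.reg top ∧
      ∀ v, σ.arr label v ≠ n → τ.arr label v ≠ n := by
  obtain ⟨hV, hC, hbin, hhead, hadj, hdfs⟩ := hσ
  obtain ⟨tp, htp⟩ : ∃ tp, σ.reg top = tp + 1 := ⟨σ.reg top - 1, by omega⟩
  rw [htp] at hdfs ⊢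
  have hxn := (hdfs.stack_mem tp (by omega)).1
  refine .of_wp (by decide) ?_
  simp only [exploreStep, Cmd.wp, Exp.eval, Exp.eval_sub, Test.Holds, Store.setReg_arr, Store.setArr_arr_self,
    Store.setArr_reg, Store.setReg_reg_self, ne_eq, reduceCtorEq, not_false_eq_true,
    Store.setReg_reg_of_ne, Store.setArr_arr_of_ne, hV, hC, hbin, hhead, hadj, htp,
    Nat.add_sub_cancel]
  refine ⟨fun hx => ⟨fun hy => ?_, fun hy => ?_⟩, fun hx => ?_⟩
  · have h1 := hdfs.visit hR hRG hc hx hy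
    have h2 := arcsLeft_update hxn hx
    refine ⟨⟨by simpa, by simpa, by simpa, by simpa, by simpa, by simpa using h1⟩, by omega,
      fun v hv => ?_⟩
    rw [Function.update_apply]
    split_ifs
    · exact hc.ne
    · exact hv
  · have h1 := hdfs.skip_visited hR (by omega) hx hy
    have h2 := arcsLeft_update hxn hx
    refine ⟨⟨by simpa, by simpa, by simpa, by simpa, by simpa, by simpa [htp] using h1⟩, by omega,
      fun v hv => hv⟩
  · have h1 := hdfs.pop hx
    refine ⟨⟨by simpa, by simpa, by simpa, by simpa, by simpa, by simpa using h1⟩, by omega,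
      fun v hv => hv⟩

/-- A single search may take linear time, so its cost is amortised over all roots: the arcs
unexplored at the start, at most 2n, pay for all rounds. At the end the stack is empty, hence every
arc is explored and labels agree along `R`. -/
theorem connectedComponents_runs {n : ℕ} {σ : Store} {G : SimpleGraph ℕ} {R : ℕ → ℕ → Prop}
    (hn : σ.reg numV = n)
    (hR : IsArcList n R (σ.arr bin) (fun q => σ.arr head (σ.arr adj q)))
    (hRG : ∀ v w, R v w → G.Adj v w) :
    Runs connectedComponents σ (1000 * (n + 1)) fun τ =>
      IsLabelling n (τ.reg numComp) G R (τ.arr label) := by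
  set bn := σ.arr bin with hbn
  set hd : ℕ → ℕ := σ.arr head with hhd
  set ad : ℕ → ℕ := σ.arr adj with had
  have main : Runs connectedComponents σ (2 + ((n + 1) * (12 + 1 + 7) + (2 +
      ((n + 1) * (80 + 1 + 7) + 4 * n * 54)))) fun τ => (∀ v < n, τ.arr label v ≠ n) ∧
        τ.reg numComp ≤ n ∧
        IsDFS n (τ.reg numComp) G bn (fun q => hd (ad q)) (τ.arr label) (τ.arr next)
          (τ.arr stack) 0 := by
    refine .seq_agree (Runs.of_wp (K := 2) (Q := fun τ => τ.arr = σ.arr ∧ τ.reg total = 0)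
      (by decide) (by simp)) ?_
    intro τ₁ hA₁ ⟨hτ₁, ht₁⟩
    have hV₁ : τ₁.reg numV = n := (hA₁.reg numV rfl).trans hn
    refine .seq_agree (Runs.forLoop (K := 12) n (fun k τ => τ.reg total = arcStart bn k ∧
      ∀ v < k, τ.arr label v = n ∧ τ.arr next v = arcStart bn v) rfl
      (fun τ hτ => (hτ.reg numV rfl).trans hV₁) (by simp [ht₁, arcStart]) ?_) ?_
    · intro k hk τ hA hi ⟨ht, hI⟩
      have hV : τ.reg numV = n := (hA.reg numV rfl).trans hV₁
      have hb : τ.arr bin = bn := (hA.arr bin rfl).trans (by rw [hτ₁])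
      refine .of_wp (by decide) ?_
      simp only [Cmd.wp, Exp.eval, Store.setReg_arr, Store.setArr_arr_self,
        Store.setArr_reg, Store.setReg_reg_self, ne_eq, reduceCtorEq, not_false_eq_true,
        Store.setReg_reg_of_ne, Store.setArr_arr_of_ne, hV, hb, hi, ht, Function.update_apply]
      refine ⟨by simp [arcStart], fun v hv => ?_⟩
      split_ifs with h
      · simp [h]
      · exact hI v (by omega)
    intro τ₂ hA₂ ⟨_, _, hI₂⟩
    have hV₂ : τ₂.reg numV = n := (hA₂.reg numV rfl).trans hV₁
    have hb₂ : τ₂.arr bin = bn := (hA₂.arr bin rfl).trans (by rw [hτ₁])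
    have hh₂ : τ₂.arr head = hd := (hA₂.arr head rfl).trans (by rw [hτ₁])
    have ha₂ : τ₂.arr adj = ad := (hA₂.arr adj rfl).trans (by rw [hτ₁])
    refine .seq_agree (Runs.of_wp (K := 2) (Q := fun τ => τ.arr = τ₂.arr ∧ τ.reg numComp = 0)
      (by decide) (by simp)) ?_
    intro τ₃ hA₃ ⟨hτ₃, hc₃⟩
    have hV₃ : τ₃.reg numV = n := (hA₃.reg numV rfl).trans hV₂
    -- The stack is empty between two roots, so its height drops out of the potential. The factor 54
    -- below is the cost of one round: 4 for test and branch, 50 for the body.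
    let μ : Store → ℕ := fun τ => 2 * arcsLeft n bn (τ.arr next)
    have hinit : ∀ v < n, τ₃.arr label v = n ∧ τ₃.arr next v = arcStart bn v := by
      rw [hτ₃]; exact hI₂
    have hμ : μ τ₃ ≤ 4 * n := by
      have h1 := arcsLeft_arcStart hR
      have h2 : arcsLeft n bn (τ₃.arr next) = arcsLeft n bn (arcStart bn) :=
        Finset.sum_congr rfl fun v hv => by rw [(hinit v (Finset.mem_range.1 hv)).2]
      simp only [μ, h2]; omega
    have hloop := RunsWith.forLoop (Φ := fun τ => μ τ * 54) (K := 80) (σ := τ₃) (r := i)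
      (bound := numV)
      (c := ite (eq (get label i) numV) (put label i numComp ;; put stack 0 i ;; set top 1 ;;
        .loop (lt 0 top) exploreStep ;; set numComp (numComp + 1)) skip) n
      (fun k τ => τ.reg numComp ≤ k ∧ (∀ v < k, τ.arr label v ≠ n) ∧
        IsDFS n (τ.reg numComp) G bn (fun q => hd (ad q)) (τ.arr label) (τ.arr next)
          (τ.arr stack) 0) rfl (fun _ _ => rfl)
      (fun τ hτ => (hτ.reg numV rfl).trans hV₃) ?_ ?_
    · obtain ⟨t, τ, h1, h2, -, h3, h4, h5⟩ := hloop
      refine ⟨t, τ, h1, ?_, h4, h3, h5⟩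
      have : μ τ₃ * 54 ≤ 4 * n * 54 := Nat.mul_le_mul_right _ hμ
      simp only [Exp.cost] at h2
      omega
    · simp only [Store.setReg_arr, ne_eq, reduceCtorEq, not_false_eq_true,
        Store.setReg_reg_of_ne, hc₃]
      refine ⟨le_rfl, by simp, by simp, fun v hv => (hinit v hv).2.ge, fun v hv => ?_,
        fun v hv => Or.inl (hinit v hv).1, fun v hv q h1 h2 => ?_,
        fun v hv h => absurd (hinit v hv).1 h, fun b hb a ha => ?_, by simp⟩
      · rw [(hinit v hv).2]; exact hR.start_le v hv
      · rw [(hinit v hv).2] at h2; omega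
      · exact absurd ((hinit a ha.1).1.symm.trans ha.2).symm hb
    · intro k hk τ hA hi ⟨hck, hlk, hdfs⟩
      have hV : τ.reg numV = n := (hA.reg numV rfl).trans hV₃
      have hb : τ.arr bin = bn := (hA.arr bin rfl).trans (by rw [hτ₃, hb₂])
      have hh : τ.arr head = hd := (hA.arr head rfl).trans (by rw [hτ₃, hh₂])
      have ha : τ.arr adj = ad := (hA.arr adj rfl).trans (by rw [hτ₃, ha₂])
      refine .ite (K := 3 + (3 + (2 + (58 + 4)))) (fun hl => ?_) (fun hl => ?_) (by decide)
      · simp only [Test.Holds, Exp.eval, hi, hV] at hl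
        have hroot := hdfs.push_root (by omega) hk hl
        set c := τ.reg numComp with hc
        have hstep : ∀ (d : Cmd) (υ φ : Store) (K : ℕ), d.wc ≤ K → d.wp (· = φ) υ →
            μ φ = μ υ → RunsWith (fun τ => μ τ * 54) d υ K (· = φ) := fun d υ φ K h1 h2 h3 =>
          Runs.runsWith (D := 0) ((Runs.of_wp h1 h2).mono le_rfl fun _ h => by
            subst h; exact ⟨by rw [h3, zero_add], rfl⟩) (by omega)
        refine .seq (K := 3) (hstep (put label i numComp) τ (τ.setArr label k c) _
          (by decide) (by simp [hi, hc])
          (by simp [μ])) ?_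
        rintro _ - rfl
        refine .seq (K := 3) (hstep (put stack 0 i) _ ((τ.setArr label k c).setArr stack 0 k) _ (by decide)
          (by simp [hi]) (by simp [μ])) ?_
        rintro _ - rfl
        refine .seq (K := 2) (hstep (set top 1) _
          (((τ.setArr label k c).setArr stack 0 k).setReg top 1) _ (by decide) (by simp)
          (by simp [μ])) ?_
        rintro υ - hυ
        -- 58 = 4 for the failing test plus 54 for the root that is on the stack at the beginning.
        refine .seq (K := 58) (P := fun φ => (ExploreInv n c G bn hd ad φ ∧
          ∀ v, υ.arr label v ≠ n → φ.arr label v ≠ n) ∧ φ.reg top = 0) ?_ ?_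
        · have hinv : ExploreInv n c G bn hd ad υ := by
            refine ⟨?_, ?_, ?_, ?_, ?_, ?_⟩
            · simp [hυ, hV]
            · simp [hυ, ← hc]
            · simp [hυ, hb]
            · simp [hυ, hh]
            · simp [hυ, ha]
            · simpa [hυ, hi, ← hc] using hroot
          obtain ⟨t, φ, h1, h2, h3, h4⟩ := RunsWith.loop (K := 50) (c := exploreStep)
            (p := lt 0 top) (fun τ => 2 * arcsLeft n bn (τ.arr next) + τ.reg top)
            (Inv := fun φ => ExploreInv n c G bn hd ad φ ∧
              ∀ v, υ.arr label v ≠ n → φ.arr label v ≠ n) (fun φ hφ hp =>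
                (exploreStep_runs hR hRG (by omega) hφ.1 hp).mono le_rfl fun ψ hψ =>
                  ⟨⟨hψ.1, fun v hv => hψ.2.2 v (hφ.2 v hv)⟩, hψ.2.1⟩) υ ⟨hinv, fun v hv => hv⟩
          · have ht : φ.reg top = 0 := by simpa using h4
            have ht' : υ.reg top = 1 := by simp [hυ]
            refine ⟨t, φ, h1, ?_, h3, ht⟩
            have e' : (lt 0 top).cost + 1 = 4 := rfl
            simp only [e', ht, ht'] at h2
            change t + 2 * arcsLeft n bn (φ.arr next) * 54 ≤
              58 + 2 * arcsLeft n bn (υ.arr next) * 54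
            omega
        · rintro φ - ⟨⟨⟨-, hφc, -, -, -, hφ⟩, hmono⟩, ht⟩
          refine Runs.runsWith (K := 4) (D := 0) (.of_wp (by decide) ?_) (by omega)
          simp only [Cmd.wp, Exp.eval, Store.setReg_arr, ne_eq,
            reduceCtorEq, not_false_eq_true, Store.setReg_reg_of_ne, Store.setReg_reg_self, hφc]
          refine ⟨by simp [μ], by omega, fun v hv => hmono v ?_, by rw [ht] at hφ; exact hφ⟩
          simp only [hυ, Store.setReg_arr, Store.setArr_arr_self, ne_eq, reduceCtorEq,
            not_false_eq_true, Store.setArr_arr_of_ne, Function.update_apply]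
          split_ifs with hvk
          · omega
          · exact hlk v (by omega)
      · simp only [Test.Holds, Exp.eval, hi, hV] at hl
        refine Runs.runsWith (K := 1) (D := 0) (.of_wp (by decide) ?_) (by omega)
        simp only [Cmd.wp, Store.setReg_arr, ne_eq, reduceCtorEq, not_false_eq_true,
          Store.setReg_reg_of_ne]
        refine ⟨by omega, by omega, fun v hv => ?_, hdfs⟩
        rcases Nat.lt_succ_iff_lt_or_eq.1 hv with hv | rfl
        · exact hlk v hv
        · exact hl
  refine main.mono (by omega) ?_
  rintro τ ⟨hlab, hcn, h⟩
  have hlt : ∀ v < n, τ.arr label v < τ.reg numComp := fun v hv =>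
    (h.label_lt v hv).resolve_left (hlab v hv)
  refine ⟨hlt, h.attained, fun b hb => h.connected b (by omega), fun v hv w hw hvw => ?_⟩
  obtain ⟨q, hq1, hq2, rfl⟩ := hR.complete v hv w hw hvw
  rcases h.finished v hv (hlab v hv) with h1 | ⟨-, p, hp, -⟩
  · exact (h.explored v hv q hq1 (h1 ▸ hq2)).2.symm
  · omega

end SuperHierarchy

namespace SuperHierarchy

open Reg Arr WArr Exp Test Cmd

/-! ## Contraction -/

/-- Each class contains a vertex together with its `R`-neighbour, which is a different vertex. -/
theorem IsLabelling.two_mul_le {n c : ℕ} {G : SimpleGraph ℕ} {R : ℕ → ℕ → Prop} {lab : ℕ → ℕ}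
    (h : IsLabelling n c G R lab) (hRG : ∀ v w, R v w → G.Adj v w)
    (hR : ∀ v < n, ∃ w < n, R v w) : 2 * c ≤ n := by
  classical
  have h1 := Finset.card_eq_sum_card_fiberwise (s := Finset.range n) (t := Finset.range c) (f := lab)
    (fun v hv => by simpa using h.lt v (by simpa using hv))
  rw [Finset.card_range] at h1
  have h2 : (Finset.range c).card • 2 ≤
      ∑ b ∈ Finset.range c, ((Finset.range n).filter fun v => lab v = b).card := by
    apply Finset.card_nsmul_le_sum
    intro b hb
    obtain ⟨v, hv, rfl⟩ := h.attained b (Finset.mem_range.1 hb)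
    obtain ⟨w, hw, hvw⟩ := hR v hv
    apply Finset.one_lt_card.2
    refine ⟨v, by simp [hv], w, by simp [hw, h.eq v hv w hw hvw], (hRG v w hvw).ne⟩
  rw [Finset.card_range, smul_eq_mul] at h2
  omega

/-- Walks project to the quotient, which gives connectedness. The label classes are connected branch
sets, so the contracted graph is a minor and remains weakly drawable. -/
theorem IsGraph.contract {n m c m' : ℕ} {s d s' d' lab : ℕ → ℕ} {R : ℕ → ℕ → Prop}
    (h : IsGraph n m s d) (hl : IsLabelling n c (arrGraph s d m) R lab)
    (hlt : ∀ j < m', s' j < d' j)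
    (hinj : ∀ j < m', ∀ j' < m', s' j = s' j' → d' j = d' j' → j = j')
    (horigin : ∀ j < m', ∃ k < m, s' j = min (lab (s k)) (lab (d k)) ∧
      d' j = max (lab (s k)) (lab (d k)))
    (hcomplete : ∀ k < m, lab (s k) ≠ lab (d k) → ∃ j < m',
      s' j = min (lab (s k)) (lab (d k)) ∧ d' j = max (lab (s k)) (lab (d k))) :
    IsGraph c m' s' d' := by
  have hd' : ∀ j < m', d' j < c := by
    intro j hj
    obtain ⟨k, hk, -, h2⟩ := horigin j hj
    rw [h2]
    exact max_lt (hl.lt _ (h.src_lt k hk)) (hl.lt _ (h.dst_lt k hk))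
  have hadj : ∀ a b, (arrGraph s d m).Adj a b → lab a ≠ lab b →
      (arrGraph s' d' m').Adj (lab a) (lab b) := by
    rintro a b ⟨-, k, hk, hab⟩ hne
    have hne' : lab (s k) ≠ lab (d k) := by
      rcases hab with ⟨rfl, rfl⟩ | ⟨rfl, rfl⟩
      · exact hne
      · exact hne.symm
    obtain ⟨j, hj, h1, h2⟩ := hcomplete k hk hne'
    refine ⟨hne, j, hj, ?_⟩
    rcases hab with ⟨rfl, rfl⟩ | ⟨rfl, rfl⟩ <;> omega
  refine ⟨fun j hj => (hlt j hj).trans (hd' j hj), hd', fun j hj => (hlt j hj).ne, ?_, ?_, ?_⟩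
  · intro j hj j' hj' hjj
    have h1 := hlt j hj
    have h2 := hlt j' hj'
    rcases Sym2.eq_iff.1 hjj with ⟨h3, h4⟩ | ⟨h3, h4⟩
    · exact hinj j hj j' hj' h3 h4
    · omega
  · intro a ha b hb
    obtain ⟨v, hv, rfl⟩ := hl.attained a ha
    obtain ⟨w, hw, rfl⟩ := hl.attained b hb
    obtain ⟨p⟩ := h.connected v hv w hw
    clear ha hb hv hw
    induction p with
    | nil => exact .rfl
    | cons hab _ ih =>
      rename_i a b _ _
      by_cases hne : lab a = lab b
      · rw [hne]; exact ih
      · exact (hadj a b hab hne).reachable.trans ih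
  · refine h.drawable.of_minor (B := fun b => {v | v < n ∧ lab v = b ∧ b < c})
      ⟨fun x y v hx hy => hx.2.1.symm.trans hy.2.1, fun b => ?_, ?_⟩
    · by_cases hb : b < c
      · have := hl.connected b hb
        simpa [hb] using this
      · intro a ha; exact absurd ha.2.2 hb
    · rintro x y ⟨-, j, hj, hxy⟩
      obtain ⟨k, hk, h1, h2⟩ := horigin j hj
      have e1 := h.src_lt k hk
      have e2 := h.dst_lt k hk
      have f1 := hl.lt _ e1
      have f2 := hl.lt _ e2
      have hA : (arrGraph s d m).Adj (s k) (d k) := ⟨h.ne k hk, k, hk, Or.inl ⟨rfl, rfl⟩⟩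
      have : (lab (s k) = x ∧ lab (d k) = y) ∨ (lab (s k) = y ∧ lab (d k) = x) := by omega
      rcases this with ⟨rfl, rfl⟩ | ⟨rfl, rfl⟩
      · exact ⟨s k, ⟨e1, rfl, f1⟩, d k, ⟨e2, rfl, f2⟩, hA⟩
      · exact ⟨d k, ⟨e2, rfl, f2⟩, s k, ⟨e1, rfl, f1⟩, hA.symm⟩

/-- The first `N` entries of `ns` and `nd` list, in increasing order, the different pairs
`(lo q, hi q)` with `lo q ≠ hi q` and `q < k`. -/
structure IsFlat (lo hi : ℕ → ℕ) (k N : ℕ) (ns nd : ℕ → ℕ) : Prop where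
  le : N ≤ k
  lt : ∀ j < N, ns j < nd j
  origin : ∀ j < N, ∃ q < k, ns j = lo q ∧ nd j = hi q
  complete : ∀ q < k, lo q ≠ hi q → ∃ j < N, ns j = lo q ∧ nd j = hi q
  strict : ∀ j' < N, ∀ j < j', ns j < ns j' ∨ ns j = ns j' ∧ nd j < nd j'

namespace IsFlat

variable {lo hi : ℕ → ℕ} {k N : ℕ} {ns nd : ℕ → ℕ}

theorem step_of_exists (h : IsFlat lo hi k N ns nd)
    (hk : lo k ≠ hi k → ∃ j < N, ns j = lo k ∧ nd j = hi k) : IsFlat lo hi (k + 1) N ns nd := by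
  refine ⟨by have := h.le; omega, h.lt, fun j hj => ?_, fun q hq hne => ?_, h.strict⟩
  · obtain ⟨q, hq, h1⟩ := h.origin j hj
    exact ⟨q, by omega, h1⟩
  · rcases Nat.lt_succ_iff_lt_or_eq.1 hq with hq | rfl
    · exact h.complete q hq hne
    · exact hk hne

/-- In sorted order, comparison with the last entry suffices: that entry is at most the new pair,
hence strictly smaller if different, and all earlier entries are smaller still. -/
theorem append (h : IsFlat lo hi k N ns nd) (hle : lo k < hi k)
    (hsort : ∀ q < k, lo q < lo k ∨ lo q = lo k ∧ hi q ≤ hi k)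
    (hlast : ¬ (0 < N ∧ ns (N - 1) = lo k ∧ nd (N - 1) = hi k)) :
    IsFlat lo hi (k + 1) (N + 1) (Function.update ns N (lo k)) (Function.update nd N (hi k)) := by
  refine ⟨by have := h.le; omega, fun j hj => ?_, fun j hj => ?_, fun q hq hne => ?_,
    fun j' hj' j hj => ?_⟩
  · rcases Nat.lt_succ_iff_lt_or_eq.1 hj with hj | rfl
    · simpa [hj.ne] using h.lt j hj
    · simpa
  · rcases Nat.lt_succ_iff_lt_or_eq.1 hj with hj | rfl
    · obtain ⟨q, hq, h1⟩ := h.origin j hj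
      exact ⟨q, by omega, by simpa [hj.ne] using h1⟩
    · exact ⟨k, by omega, by simp⟩
  · rcases Nat.lt_succ_iff_lt_or_eq.1 hq with hq | rfl
    · obtain ⟨j, hj, h1⟩ := h.complete q hq hne
      exact ⟨j, by omega, by simpa [hj.ne] using h1⟩
    · exact ⟨N, by omega, by simp⟩
  · rcases Nat.lt_succ_iff_lt_or_eq.1 hj' with hj' | rfl
    · have h1 : j ≠ N := by omega
      simpa [hj'.ne, h1] using h.strict j' hj' j hj
    · simp only [Function.update_self, Function.update_of_ne hj.ne]
      have hl : ns (j' - 1) < lo k ∨ ns (j' - 1) = lo k ∧ nd (j' - 1) < hi k := by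
        obtain ⟨q, hq, h1, h2⟩ := h.origin (j' - 1) (by omega)
        have := hsort q hq
        omega
      rcases eq_or_ne j (j' - 1) with rfl | hne
      · exact hl
      · have := h.strict (j' - 1) (by omega) j (by omega)
        omega

end IsFlat

/-- The loop that merges parallel edges. -/
theorem flatten_runs {m : ℕ} {σ : Store} (hm : σ.reg numE = m)
    (hle : ∀ q < m, σ.arr lo (σ.arr perm2 q) ≤ σ.arr hi (σ.arr perm2 q))
    (hsort : ∀ q' < m, ∀ q < q', σ.arr lo (σ.arr perm2 q) < σ.arr lo (σ.arr perm2 q') ∨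
      σ.arr lo (σ.arr perm2 q) = σ.arr lo (σ.arr perm2 q') ∧
      σ.arr hi (σ.arr perm2 q) ≤ σ.arr hi (σ.arr perm2 q')) (hN : σ.reg numNew = 0) :
    Runs (forLoop i numE (
      set e (get perm2 i) ;;
      ite (eq (get lo e) (get hi e)) skip (
        ite (and (lt 0 numNew) (and (eq (get newSrc (numNew - 1)) (get lo e))
            (eq (get newDst (numNew - 1)) (get hi e))))
          (ite (wlt weight e newWeight (numNew - 1)) (
            wput newWeight (numNew - 1) weight e ;;
            put newName (numNew - 1) (get name e))
            skip) (
          put newSrc numNew (get lo e) ;;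
          put newDst numNew (get hi e) ;;
          put newName numNew (get name e) ;;
          wput newWeight numNew weight e ;;
          set numNew (numNew + 1))))) σ ((m + 1) * (100 + 1 + 7)) fun τ =>
      IsFlat (fun q => σ.arr lo (σ.arr perm2 q)) (fun q => σ.arr hi (σ.arr perm2 q)) m
        (τ.reg numNew) (τ.arr newSrc) (τ.arr newDst) := by
  refine Runs.mono (Runs.forLoop (K := 100) m (fun k τ =>
    IsFlat (fun q => σ.arr lo (σ.arr perm2 q)) (fun q => σ.arr hi (σ.arr perm2 q)) k
        (τ.reg numNew) (τ.arr newSrc) (τ.arr newDst)) rfl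
    (fun τ hτ => (hτ.reg numE rfl).trans hm) ?_ ?_) le_rfl fun τ h => h.2
  · simp only [Store.setReg_arr, ne_eq, reduceCtorEq, not_false_eq_true,
      Store.setReg_reg_of_ne, hN]
    exact ⟨le_rfl, by simp, by simp, by simp, by simp⟩
  · intro k hk τ hA hi' hI
    have e1 : τ.arr lo = σ.arr lo := hA.arr lo rfl
    have e2 : τ.arr hi = σ.arr hi := hA.arr hi rfl
    have e3 : τ.arr perm2 = σ.arr perm2 := hA.arr perm2 rfl
    refine .of_wp (by decide) ?_
    simp only [Cmd.wp, Exp.eval, Exp.eval_sub, Test.Holds,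
      Store.setReg_arr, Store.setArr_arr_self, Store.setArr_reg, Store.setReg_reg_self, ne_eq,
      reduceCtorEq, not_false_eq_true, Store.setReg_reg_of_ne, Store.setArr_arr_of_ne,
      Store.setWt_arr, hi', e1, e2, e3]
    refine ⟨fun h1 => hI.step_of_exists fun h => absurd h1 h,
      fun h1 => ⟨fun h2 => ⟨fun _ => hI.step_of_exists fun _ => ?_,
        fun _ => hI.step_of_exists fun _ => ?_⟩, fun h2 => ?_⟩⟩
    · exact ⟨τ.reg numNew - 1, by have := h2.1; omega, h2.2⟩
    · exact ⟨τ.reg numNew - 1, by have := h2.1; omega, h2.2⟩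
    · exact hI.append (lt_of_le_of_ne (hle k hk) h1) (hsort k hk) h2

end SuperHierarchy

/-! ### Running time and result of a contraction -/

namespace SuperHierarchy

open Reg Arr WArr Exp Test Cmd

/-- Stability makes the two sorts, first by the larger and then by the smaller end, lexicographic.
Parallel edges become adjacent and are merged in one pass. -/
theorem contract_runs {n m c : ℕ} {σ : Store} {R : ℕ → ℕ → Prop} (h : Holds n m σ)
    (hc : σ.reg numComp = c)
    (hl : IsLabelling n c (arrGraph (σ.arr src) (σ.arr dst) m) R (σ.arr label)) :
    Runs contract σ (1000 * (c + m + 1)) fun τ => ∃ m', Holds c m' τ := by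
  set s := σ.arr src with hs
  set d := σ.arr dst with hd
  set lab := σ.arr label with hlab
  set lo' : ℕ → ℕ := fun k => min (lab (s k)) (lab (d k)) with hlo'
  set hi' : ℕ → ℕ := fun k => max (lab (s k)) (lab (d k)) with hhi'
  have hhic : ∀ k < m, hi' k < c := fun k hk =>
    max_lt (hl.lt _ (h.graph.src_lt k hk)) (hl.lt _ (h.graph.dst_lt k hk))
  have hloc : ∀ k < m, lo' k < c := fun k hk => (min_le_max).trans_lt (hhic k hk)
  refine Runs.mono (K := (m + 1) * (60 + 1 + 7) + ((c + m + 1) * (2 * (1 + 1) + 80) +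
    ((c + m + 1) * (2 * (1 + 1) + 80) + (2 + ((m + 1) * (100 + 1 + 7) +
    ((m + 1) * (30 + 1 + 7) + 4)))))) ?_ (by omega) fun _ h => h
  refine .seq_agree (Runs.forLoop (K := 60) m (fun k τ => ∀ q < k, τ.arr lo q = lo' q ∧
    τ.arr hi q = hi' q ∧ τ.arr perm0 q = q) rfl
    (fun τ hτ => (hτ.reg numE rfl).trans h.numE) (by simp) ?_) ?_
  · intro k hk τ hA hik hI
    have e1 : τ.arr src = s := hA.arr src rfl
    have e2 : τ.arr dst = d := hA.arr dst rfl
    have e3 : τ.arr label = lab := hA.arr label rfl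
    refine .of_wp (by decide) ?_
    simp only [Cmd.wp, Exp.eval, Test.Holds, Store.setReg_arr, Store.setArr_arr_self,
      Store.setArr_reg, Store.setReg_reg_self, ne_eq, reduceCtorEq, not_false_eq_true,
      Store.setReg_reg_of_ne, Store.setArr_arr_of_ne, hik, e1, e2, e3]
    refine ⟨fun hlt q hq => ?_, fun hlt q hq => ?_⟩
    all_goals
      rcases Nat.lt_succ_iff_lt_or_eq.1 hq with hq | rfl
      · simpa [hq.ne] using hI q hq
      · simp only [Function.update_self, hlo', hhi', and_true]
        omega
  intro τ₁ hA₁ ⟨_, hI₁⟩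
  have hE₁ : τ₁.reg numE = m := (hA₁.reg numE rfl).trans h.numE
  have hC₁ : τ₁.reg numComp = c := (hA₁.reg numComp rfl).trans hc
  refine .seq_agree (histogramSort_runs (R := c) (L := m) (by decide) (by decide) (by decide)
    (by decide) (by decide) (fun τ hτ => (hτ.reg numComp rfl).trans hC₁)
    (fun τ hτ => (hτ.reg numE rfl).trans hE₁) fun p hp => ?_) ?_
  · rw [(hI₁ p hp).2.2, (hI₁ p hp).2.1]; exact hhic p hp
  intro τ₂ hA₂ ⟨_, pos, hpos⟩
  have hE₂ : τ₂.reg numE = m := (hA₂.reg numE rfl).trans hE₁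
  have hC₂ : τ₂.reg numComp = c := (hA₂.reg numComp rfl).trans hC₁
  have hlo₂ : ∀ q < m, τ₂.arr lo q = lo' q := fun q hq => by
    rw [hA₂.arr lo rfl]; exact (hI₁ q hq).1
  have hhi₂ : ∀ q < m, τ₂.arr hi q = hi' q := fun q hq => by
    rw [hA₂.arr hi rfl]; exact (hI₁ q hq).2.1
  have hperm₁ : ∀ p < m, τ₂.arr perm1 (pos p) = p := fun p hp => by
    rw [hpos.eq p hp, (hI₁ p hp).2.2]
  have hperm₁' : ∀ q < m, τ₂.arr perm1 q < m := fun q hq => by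
    obtain ⟨p, hp, rfl⟩ := hpos.surj q hq
    rw [hperm₁ p hp]; exact hp
  refine .seq_agree (histogramSort_runs (R := c) (L := m) (by decide) (by decide) (by decide)
    (by decide) (by decide) (fun τ hτ => (hτ.reg numComp rfl).trans hC₂)
    (fun τ hτ => (hτ.reg numE rfl).trans hE₂) fun p hp => ?_) ?_
  · rw [hlo₂ _ (hperm₁' p hp)]; exact hloc _ (hperm₁' p hp)
  intro τ₃ hA₃ ⟨_, pos', hpos'⟩
  have hE₃ : τ₃.reg numE = m := (hA₃.reg numE rfl).trans hE₂
  have hC₃ : τ₃.reg numComp = c := (hA₃.reg numComp rfl).trans hC₂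
  set P := τ₃.arr perm2 with hP
  have hPpos : ∀ p < m, P (pos' (pos p)) = p := fun p hp => by
    rw [hpos'.eq _ (hpos.lt p hp), hperm₁ p hp]
  have hPsurj : ∀ q < m, ∃ p < m, pos' (pos p) = q := fun q hq => by
    obtain ⟨p, hp, rfl⟩ := hpos'.surj q hq
    obtain ⟨p, hp', rfl⟩ := hpos.surj p hp
    exact ⟨p, hp', rfl⟩
  have hPlt : ∀ q < m, P q < m := fun q hq => by
    obtain ⟨p, hp, rfl⟩ := hPsurj q hq
    rw [hPpos p hp]; exact hp
  -- If the order were wrong, either the second sort would exchange the two entries, or, for equal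
  -- smaller ends, the first sort would and the second would preserve that.
  have hsort : ∀ q' < m, ∀ q < q', lo' (P q) < lo' (P q') ∨
      lo' (P q) = lo' (P q') ∧ hi' (P q) ≤ hi' (P q') := by
    intro q' hq' q hqq
    obtain ⟨p', hp', rfl⟩ := hPsurj q' hq'
    obtain ⟨p, hp, rfl⟩ := hPsurj q (by omega)
    rw [hPpos p hp, hPpos p' hp']
    have h1 := hpos'.mono (pos p') (hpos.lt p' hp') (pos p) (hpos.lt p hp)
    simp only [hperm₁ p hp, hperm₁ p' hp', hlo₂ p hp, hlo₂ p' hp'] at h1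
    have h2 := hpos.mono p' hp' p hp
    simp only [(hI₁ p hp).2.2, (hI₁ p' hp').2.2, (hI₁ p hp).2.1, (hI₁ p' hp').2.1] at h2
    by_contra hcon
    rw [not_or, not_and, not_lt, not_le] at hcon
    obtain ⟨h3, h4⟩ := hcon
    rcases lt_or_eq_of_le h3 with h5 | h5
    · have := h1 (Or.inl h5); omega
    · have := h1 (Or.inr ⟨h5, h2 (Or.inl (h4 h5.symm))⟩); omega
  refine .seq_agree (Runs.of_wp (K := 2) (Q := fun τ => τ.arr = τ₃.arr ∧ τ.reg numNew = 0)
    (by decide) (by simp)) ?_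
  intro τ₄ hA₄ ⟨hτ₄, hN₄⟩
  have hE₄ : τ₄.reg numE = m := (hA₄.reg numE rfl).trans hE₃
  have hC₄ : τ₄.reg numComp = c := (hA₄.reg numComp rfl).trans hC₃
  have hlo₄ : ∀ q < m, τ₄.arr lo q = lo' q := fun q hq => by
    rw [hτ₄, hA₃.arr lo rfl]; exact hlo₂ q hq
  have hhi₄ : ∀ q < m, τ₄.arr hi q = hi' q := fun q hq => by
    rw [hτ₄, hA₃.arr hi rfl]; exact hhi₂ q hq
  have hP₄ : τ₄.arr perm2 = P := by rw [hτ₄]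
  have hloP : ∀ q < m, τ₄.arr lo (τ₄.arr perm2 q) = lo' (P q) := fun q hq => by
    rw [hP₄]; exact hlo₄ _ (hPlt q hq)
  have hhiP : ∀ q < m, τ₄.arr hi (τ₄.arr perm2 q) = hi' (P q) := fun q hq => by
    rw [hP₄]; exact hhi₄ _ (hPlt q hq)
  refine .seq_agree (flatten_runs hE₄ (fun q hq => ?_) (fun q' hq' q hqq => ?_) hN₄) ?_
  · rw [hloP q hq, hhiP q hq]; exact min_le_max
  · rw [hloP q (by omega), hhiP q (by omega), hloP q' hq', hhiP q' hq']; exact hsort q' hq' q hqq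
  intro τ₅ hA₅ hF
  have hC₅ : τ₅.reg numComp = c := (hA₅.reg numComp rfl).trans hC₄
  set N := τ₅.reg numNew with hN
  refine .seq_agree (Runs.mono (Runs.forLoop (K := 30) N (fun k τ => ∀ j < k,
    τ.arr src j = τ₅.arr newSrc j ∧ τ.arr dst j = τ₅.arr newDst j) rfl
    (fun τ hτ => hτ.reg numNew rfl) (by simp) ?_)
    (Nat.mul_le_mul_right _ (Nat.succ_le_succ hF.le)) fun _ h => h) ?_
  · intro k hk τ hA hik hI
    have e1 : τ.arr newSrc = τ₅.arr newSrc := hA.arr newSrc rfl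
    have e2 : τ.arr newDst = τ₅.arr newDst := hA.arr newDst rfl
    refine .of_wp (by decide) ?_
    simp only [Cmd.wp, Exp.eval, Store.setReg_arr, Store.setArr_arr_self, Store.setArr_reg,
      ne_eq, reduceCtorEq, not_false_eq_true, Store.setArr_arr_of_ne, Store.setWt_arr, hik, e1, e2]
    intro j hj
    rcases Nat.lt_succ_iff_lt_or_eq.1 hj with hj | rfl
    · simpa [hj.ne] using hI j hj
    · simp
  intro τ₆ hA₆ ⟨_, hI₆⟩
  have hN₆ : τ₆.reg numNew = N := hA₆.reg numNew rfl
  have hC₆ : τ₆.reg numComp = c := (hA₆.reg numComp rfl).trans hC₅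
  refine .of_wp (by decide) ?_
  simp only [Cmd.wp, Exp.eval]
  refine ⟨N, by simp [hC₆], by simp [hN₆], ?_⟩
  simp only [Store.setReg_arr]
  refine h.graph.contract hl (fun j hj => ?_) (fun j hj j' hj' h1 h2 => ?_) (fun j hj => ?_)
    (fun k hk hne => ?_)
  · rw [(hI₆ j hj).1, (hI₆ j hj).2]; exact hF.lt j hj
  · rw [(hI₆ j hj).1, (hI₆ j' hj').1] at h1
    rw [(hI₆ j hj).2, (hI₆ j' hj').2] at h2
    by_contra hne
    rcases lt_or_gt_of_ne hne with h3 | h3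
    · have := hF.strict j' hj' j h3; omega
    · have := hF.strict j hj j' h3; omega
  · obtain ⟨q, hq, h1, h2⟩ := hF.origin j hj
    refine ⟨P q, hPlt q hq, ?_⟩
    rw [(hI₆ j hj).1, (hI₆ j hj).2, h1, h2]
    exact ⟨hloP q hq, hhiP q hq⟩
  · have hq : pos' (pos k) < m := hpos'.lt _ (hpos.lt k hk)
    have h3 := hloP _ hq
    have h4 := hhiP _ hq
    rw [hPpos k hk] at h3 h4
    obtain ⟨j, hj, h1, h2⟩ := hF.complete (pos' (pos k)) hq (by
      rw [h3, h4]; exact fun h => hne (inf_eq_sup.1 h))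
    refine ⟨j, hj, ?_⟩
    rw [(hI₆ j hj).1, (hI₆ j hj).2, h1, h2]
    exact ⟨h3, h4⟩

/-! ## The whole algorithm -/

/-- The bound m ≤ 32 n converts the cost O(n + m) of the four phases into O(n). -/
theorem iteration_runs {n m : ℕ} {σ : Store} (h : Holds n m σ) (hn : 1 < n) :
    Runs (nearestNeighbours ;; chooseEdges ;; connectedComponents ;; contract) σ (60000 * n)
      fun τ => ∃ c m', 2 * c ≤ n ∧ Holds c m' τ := by
  have hmn := h.graph.card_edges_le
  refine Runs.mono (K := 100 * (n + m + 1) + (400 * (n + 1) + (1000 * (n + 1) +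
    1000 * (n + m + 1)))) ?_ (by omega) fun _ h => h
  refine .seq_agree (nearestNeighbours_runs h hn) ?_
  intro τ₁ hA₁ hb
  have hs₁ : τ₁.arr src = σ.arr src := hA₁.arr src rfl
  have hd₁ : τ₁.arr dst = σ.arr dst := hA₁.arr dst rfl
  have h₁ : Holds n m τ₁ := ⟨(hA₁.reg numV rfl).trans h.numV, (hA₁.reg numE rfl).trans h.numE,
    by rw [hs₁, hd₁]; exact h.graph⟩
  refine .seq_agree (chooseEdges_runs h₁ (by rw [hs₁, hd₁]; exact hb)) ?_
  rintro τ₂ hA₂ ⟨R, hRG, hR, hlist⟩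
  have hs₂ : τ₂.arr src = τ₁.arr src := hA₂.arr src rfl
  have hd₂ : τ₂.arr dst = τ₁.arr dst := hA₂.arr dst rfl
  have h₂ : Holds n m τ₂ := ⟨(hA₂.reg numV rfl).trans h₁.numV, (hA₂.reg numE rfl).trans h₁.numE,
    by rw [hs₂, hd₂]; exact h₁.graph⟩
  rw [← hs₂, ← hd₂] at hRG
  refine .seq_agree (connectedComponents_runs h₂.numV hlist hRG) ?_
  intro τ₃ hA₃ hl
  have hs₃ : τ₃.arr src = τ₂.arr src := hA₃.arr src rfl
  have hd₃ : τ₃.arr dst = τ₂.arr dst := hA₃.arr dst rfl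
  have h₃ : Holds n m τ₃ := ⟨(hA₃.reg numV rfl).trans h₂.numV, (hA₃.reg numE rfl).trans h₂.numE,
    by rw [hs₃, hd₃]; exact h₂.graph⟩
  have hc := hl.two_mul_le hRG hR
  rw [← hs₃, ← hd₃] at hl
  refine (contract_runs h₃ rfl hl).mono ?_ fun τ ⟨m', hm'⟩ => ⟨_, m', hc, hm'⟩
  omega

/-- With c ≤ n/2 vertices left, 60000 n + 4 + (120010 c + 4) ≤ 120005 n + 8, which is at most 120010
n + 4 as n ≥ 2. Strong induction on n also yields termination. -/
theorem mainLoop_exec : ∀ n m σ, Holds n m σ → ∃ t τ, Exec (.loop (lt 1 numV)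
    (nearestNeighbours ;; chooseEdges ;; connectedComponents ;; contract)) σ t τ ∧
      t ≤ 120010 * n + 4 := by
  intro n
  induction n using Nat.strong_induction_on with
  | _ n ih =>
    intro m σ h
    by_cases hn : 1 < n
    · obtain ⟨t, τ, h1, h2, c, m', hc, hτ⟩ := iteration_runs h hn
      obtain ⟨t', υ, h3, h4⟩ := ih c (by omega) m' τ hτ
      refine ⟨_, υ, .loop_true (by simp [h.numV, hn]) h1 h3, ?_⟩
      have : (lt 1 numV).cost = 3 := rfl
      omega
    · refine ⟨_, σ, .loop_false (by simp [h.numV]; omega), ?_⟩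
      have : (lt 1 numV).cost = 3 := rfl
      omega

/-! ### The input as the first current graph -/

theorem isGraph_of_input {n m : ℕ} {G : SimpleGraph (Fin n)} {u v : Fin m → Fin n} {s d : ℕ → ℕ}
    (hconn : G.Connected) (hplanar : IsPlanar G) (hlist : IsEdgeList G u v)
    (hs : ∀ k : Fin m, s k = u k) (hd : ∀ k : Fin m, d k = v k) : IsGraph n m s d := by
  obtain ⟨hinj, hrange⟩ := hlist
  have hG : ∀ k, G.Adj (u k) (v k) := fun k => by
    have : s(u k, v k) ∈ G.edgeSet := hrange ▸ ⟨k, rfl⟩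
    exact this
  have hadj : ∀ a b : Fin n, (arrGraph s d m).Adj a b ↔ G.Adj a b := by
    intro a b
    constructor
    · rintro ⟨-, k, hk, h⟩
      have h1 := hs ⟨k, hk⟩
      have h2 := hd ⟨k, hk⟩
      have h3 := hG ⟨k, hk⟩
      simp only at h1 h2
      rcases h with ⟨ha, hb⟩ | ⟨ha, hb⟩
      · rwa [Fin.ext (h1.symm.trans ha), Fin.ext (h2.symm.trans hb)] at h3
      · rw [Fin.ext (h1.symm.trans ha), Fin.ext (h2.symm.trans hb)] at h3
        exact h3.symm
    · intro hab
      have : s(a, b) ∈ Set.range fun k => s(u k, v k) := hrange ▸ hab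
      obtain ⟨k, hk⟩ := this
      refine ⟨fun h => hab.ne (Fin.ext h), k, k.2, ?_⟩
      rw [hs, hd]
      rcases Sym2.eq_iff.1 hk with ⟨rfl, rfl⟩ | ⟨rfl, rfl⟩
      · exact Or.inl ⟨rfl, rfl⟩
      · exact Or.inr ⟨rfl, rfl⟩
  have hsn : ∀ k < m, s k < n := fun k hk => by rw [hs ⟨k, hk⟩]; exact (u _).2
  have hdn : ∀ k < m, d k < n := fun k hk => by rw [hd ⟨k, hk⟩]; exact (v _).2
  refine ⟨hsn, hdn, fun k hk h => ?_, fun k hk k' hk' h => ?_, fun a ha b hb => ?_, ?_⟩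
  · rw [hs ⟨k, hk⟩, hd ⟨k, hk⟩] at h
    exact (hG ⟨k, hk⟩).ne (Fin.ext h)
  · rw [hs ⟨k, hk⟩, hd ⟨k, hk⟩, hs ⟨k', hk'⟩, hd ⟨k', hk'⟩] at h
    have : (fun k => s(u k, v k)) ⟨k, hk⟩ = (fun k => s(u k, v k)) ⟨k', hk'⟩ := by
      apply Sym2.map.injective Fin.val_injective
      simpa using h
    exact congrArg Fin.val (hinj this)
  · have := hconn.preconnected ⟨a, ha⟩ ⟨b, hb⟩
    let f : G →g arrGraph s d m := ⟨Fin.val, fun {a b} h => (hadj a b).2 h⟩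
    exact this.map f
  -- The graph on ℕ is a minor of `G` with branch sets that are singletons below n and empty from n
  -- on.
  · refine hplanar.weaklyDrawable.of_minor (B := fun k => {a : Fin n | (a : ℕ) = k})
      ⟨fun x y a hx hy => Eq.trans (Eq.symm hx) hy, fun x a ha b hb => ?_, ?_⟩
    · have : a = b := Fin.ext (Eq.trans ha (Eq.symm hb))
      rw [this]
    · intro x y h
      have h' := h
      obtain ⟨-, k, hk, hxy⟩ := h
      have h1 := hsn k hk
      have h2 := hdn k hk
      have hx : x < n := by omega
      have hy : y < n := by omega
      exact ⟨⟨x, hx⟩, rfl, ⟨y, hy⟩, rfl, (hadj ⟨x, hx⟩ ⟨y, hy⟩).1 h'⟩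

end SuperHierarchy

theorem mainTheorem1 :
    ∃ C : ℕ, ∀ (n m : ℕ) (G : SimpleGraph (Fin n)) (u v : Fin m → Fin n) (w : Fin m → ℝ)
      (σ : SuperHierarchy.Store),
      G.Connected → SuperHierarchy.IsPlanar G → SuperHierarchy.IsEdgeList G u v →
      σ.Contains u v w →
        ∃ (t : ℕ) (τ : SuperHierarchy.Store),
          SuperHierarchy.Exec SuperHierarchy.superHierarchy σ t τ ∧ t ≤ C * n := by
  refine ⟨200000, fun n m G u v w σ hconn hplanar hlist ⟨hn, hm, hk⟩ => ?_⟩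
  have hg : SuperHierarchy.IsGraph n m (σ.arr .src) (σ.arr .dst) :=
    SuperHierarchy.isGraph_of_input hconn hplanar hlist (fun k => (hk k).1) (fun k => (hk k).2.1)
  have hmn := hg.card_edges_le
  -- Positivity of n lets C n absorb the additive constants.
  have hpos : 0 < n := by
    obtain ⟨a⟩ := hconn.nonempty
    exact a.pos
  have hrun : SuperHierarchy.Runs SuperHierarchy.superHierarchy σ
      (2 + ((m + 1) * (10 + 1 + 7) + (120010 * n + 4))) fun _ => True := by
    refine .seq_agree (.of_wp (K := 2) (Q := fun τ => τ.arr = σ.arr) (by decide) (by simp)) ?_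
    intro τ₁ hA₁ hτ₁
    have hE : τ₁.reg .numE = m := (hA₁.reg .numE rfl).trans hm
    refine .seq_agree (SuperHierarchy.Runs.forLoop (K := 10) m (fun _ _ => True) rfl
      (fun τ hτ => (hτ.reg .numE rfl).trans hE) trivial
      fun k _ τ _ _ _ => .of_wp (by decide) trivial) ?_
    intro τ₂ hA₂ _
    obtain ⟨t, τ, h1, h2⟩ := SuperHierarchy.mainLoop_exec n m τ₂
      ⟨(hA₂.reg .numV rfl).trans ((hA₁.reg .numV rfl).trans hn), (hA₂.reg .numE rfl).trans hE, by
        rw [hA₂.arr .src rfl, hA₂.arr .dst rfl, hτ₁]; exact hg⟩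
    exact ⟨t, τ, h1, h2, trivial⟩
  obtain ⟨t, τ, h1, h2, -⟩ := hrun
  exact ⟨t, τ, h1, by omega⟩
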